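/- **Trees and Thompson's group $F$.** A tree is a finite rooted binary tree (every vertex has either two children or none), with leaves ordered from left to right; each leaf is identified with the finite binary sequence of left (0) and right (1) turns leading to it from the root. Write $t\preceq s$ if $t$ is a rooted subtree of $s$. Thompson's group $F$ is the group of homeomorphisms $g$ of the Cantor space $\{0,1\}^{\mathbf N}$ for which there are trees $t,s$ with the same number $n$ of leaves, $v_1,\dots,v_n$ for $s$ and $w_1,\dots,w_n$ for $t$ (from left to right), such that $g(v_k\cdot x)=w_k\cdot x$ for all $1\le k\le n$ and all infinite binary sequences $x$; one then writes $g=[t,s]$. **The representation.** Let $(a,b)\in\mathbf C^2$ with $|a|^2+|b|^2=1$. For each tree $t$ let $\mathfrak H_t=\ell^2(\mathrm{Leaf}(t),\mathbf C)$. If $s$ is obtained from $t$ by attaching a caret at the $k$-th leaf, let $\mathfrak H_t\to\mathfrak H_s$ be the isometry $$(\xi_1,\dots,\xi_n)\mapsto(\xi_1,\dots,\xi_{k-1},a\xi_k,b\xi_k,\xi_{k+1},\dots,\xi_n);$$ compositions of these maps give well-defined isometries $\mathfrak H_t\to\mathfrak H_s$ for all $t\preceq s$. Let $\mathscr H$ be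 the completion of the direct limit $\varinjlim_t\mathfrak H_t$, and write $[t,\xi]$ for the image of $\xi\in\mathfrak H_t$ in it. The Pythagorean representation $\sigma_{a,b}$ is the unitary representation of $F$ on $\mathscr H$ determined by $\sigma_{a,b}([t,s])[s,\xi]=[t,\xi]$ for all trees $t,s$ with the same number of leaves and all decorations $\xi$ of these leaves. **Ind-mixing.** A unitary representation $\sigma$ of a discrete group $G$ is called *Ind-mixing* if for every subgroup $K\neq\{e\}$ of $G$ and every non-zero finite-dimensional unitary representation $\theta$ of $K$, the induced unitary representation $\mathrm{Ind}_K^G\theta$ is not contained in $\sigma$, i.e. is not unitarily equivalent to a subrepresentation of $\sigma$. **Corollary B.** Let $(a,b)\in\mathbf C^2$ with $|a|^2+|b|^2=1$, $a\neq0$ and $b\neq 0$; that is, $(a,b)\in S^3\setminus(C_1\cup C_2)$, where $C_1=\{(a,0):|a|=1\}$ and $C_2=\{(0,b):|b|=1\}$. Then the Pythagorean representation $\sigma_{a,b}$ of $F$ on $\mathscr H$ is Ind-mixing. -/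

import Mathlib

/-! ### Finite rooted binary trees -/

/-- Finite rooted binary trees: the trivial tree, or a caret with trees attached to its two
leaves. -/
inductive BTree : Type
  | leaf : BTree
  | caret : BTree → BTree → BTree

namespace BTree

/-- The leaves of a tree. -/
inductive Leaf : BTree → Type
  | here : Leaf .leaf
  | left {l r : BTree} : Leaf l → Leaf (.caret l r)
  | right {l r : BTree} : Leaf r → Leaf (.caret l r)

/-- The finite binary sequence (`false` is `0`, `true` is `1`) of the vertex of the infinite
rooted binary tree at which a leaf sits. -/
def Leaf.word : {t : BTree} → Leaf t → List Bool
  | _, .here => []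
  | _, .left a => false :: a.word
  | _, .right a => true :: a.word

theorem Leaf.word_injective : {t : BTree} → Function.Injective (Leaf.word (t := t))
  | _, .here, .here, _ => rfl
  | _, .left a, .left b, h => by
      have := Leaf.word_injective (a₁ := a) (a₂ := b) (by simpa [Leaf.word] using h)
      rw [this]
  | _, .right a, .right b, h => by
      have := Leaf.word_injective (a₁ := a) (a₂ := b) (by simpa [Leaf.word] using h)
      rw [this]
  | _, .left a, .right b, h => by simp [Leaf.word] at h
  | _, .right a, .left b, h => by simp [Leaf.word] at h

/-- The leaves are ordered from left to right, that is, by the lexicographic order of the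
corresponding binary sequences. -/
instance (t : BTree) : LinearOrder (Leaf t) := LinearOrder.lift' Leaf.word Leaf.word_injective

def leafEquivUnit : Leaf .leaf ≃ Unit where
  toFun _ := ()
  invFun _ := .here
  left_inv := fun | .here => rfl
  right_inv _ := rfl

def leafEquivSum (l r : BTree) : Leaf (.caret l r) ≃ Leaf l ⊕ Leaf r where
  toFun := fun
    | .left a => .inl a
    | .right a => .inr a
  invFun := fun
    | .inl a => .left a
    | .inr a => .right a
  left_inv := fun
    | .left _ => rfl
    | .right _ => rfl
  right_inv := fun
    | .inl _ => rfl
    | .inr _ => rfl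

instance fintypeLeaf : (t : BTree) → Fintype (Leaf t)
  | .leaf => Fintype.ofEquiv Unit leafEquivUnit.symm
  | .caret l r =>
    letI := fintypeLeaf l
    letI := fintypeLeaf r
    Fintype.ofEquiv (Leaf l ⊕ Leaf r) (leafEquivSum l r).symm

/-- `t.IsSubtree s`: the tree `t` is a rooted subtree of the tree `s`. -/
def IsSubtree : BTree → BTree → Prop
  | .leaf, _ => True
  | .caret _ _, .leaf => False
  | .caret l r, .caret l' r' => l.IsSubtree l' ∧ r.IsSubtree r'

theorem IsSubtree.refl : (t : BTree) → t.IsSubtree t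
  | .leaf => trivial
  | .caret l r => ⟨IsSubtree.refl l, IsSubtree.refl r⟩

theorem IsSubtree.trans : {t s r : BTree} → t.IsSubtree s → s.IsSubtree r → t.IsSubtree r
  | .leaf, _, _, _, _ => trivial
  | .caret _ _, .caret _ _, .caret _ _, h, k => ⟨h.1.trans k.1, h.2.trans k.2⟩

theorem IsSubtree.antisymm : {t s : BTree} → t.IsSubtree s → s.IsSubtree t → t = s
  | .leaf, .leaf, _, _ => rfl
  | .caret _ _, .caret _ _, h, k => by rw [h.1.antisymm k.1, h.2.antisymm k.2]

/-- `t ≤ s` when `t` is a rooted subtree of `s`. -/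
instance : PartialOrder BTree where
  le := IsSubtree
  le_refl := IsSubtree.refl
  le_trans _ _ _ := IsSubtree.trans
  le_antisymm _ _ := IsSubtree.antisymm

/-- The union of two trees, as rooted subtrees of the infinite rooted binary tree. -/
def union : BTree → BTree → BTree
  | .leaf, s => s
  | .caret l r, .leaf => .caret l r
  | .caret l r, .caret l' r' => .caret (l.union l') (r.union r')

theorem le_union_left : (t s : BTree) → t ≤ t.union s
  | .leaf, _ => trivial
  | .caret l r, .leaf => IsSubtree.refl (.caret l r)
  | .caret l r, .caret l' r' => ⟨le_union_left l l', le_union_left r r'⟩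

theorem le_union_right : (t s : BTree) → s ≤ t.union s
  | .leaf, s => IsSubtree.refl s
  | .caret _ _, .leaf => trivial
  | .caret l r, .caret l' r' => ⟨le_union_right l l', le_union_right r r'⟩

instance : IsDirectedOrder BTree where
  directed t s := ⟨t.union s, le_union_left t s, le_union_right t s⟩

instance : Nonempty BTree := ⟨.leaf⟩

/-- The composition `f ∘ t` of a tree `t` with the forest `f`: the tree `f a` is attached at each
leaf `a` of `t`. -/
def graft : (t : BTree) → (Leaf t → BTree) → BTree
  | .leaf, f => f .here
  | .caret l r, f => .caret (l.graft fun a => f a.left) (r.graft fun a => f a.right)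

theorem le_graft : (t : BTree) → (f : Leaf t → BTree) → t ≤ t.graft f
  | .leaf, _ => trivial
  | .caret l r, f => ⟨le_graft l fun a => f a.left, le_graft r fun a => f a.right⟩

theorem exists_eq_graft : {t s : BTree} → t ≤ s → ∃ f : Leaf t → BTree, s = t.graft f
  | .leaf, s, _ => ⟨fun _ => s, rfl⟩
  | .caret l r, .caret l' r', h => by
      obtain ⟨f, hf⟩ := exists_eq_graft (t := l) (s := l') h.1
      obtain ⟨g, hg⟩ := exists_eq_graft (t := r) (s := r') h.2
      refine ⟨fun a => match a with
        | .left a => f a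
        | .right a => g a, ?_⟩
      simp only [graft, ← hf, ← hg]

/-- The leaf of `t.graft f` that is the leaf `b` of the tree attached at the leaf `a`. -/
def Leaf.comp : {t : BTree} → {f : Leaf t → BTree} → (a : Leaf t) → Leaf (f a) → Leaf (t.graft f)
  | _, _, .here, b => b
  | _, f, .left a, b => .left (Leaf.comp (f := fun a => f a.left) a b)
  | _, f, .right a, b => .right (Leaf.comp (f := fun a => f a.right) a b)

theorem Leaf.word_comp : {t : BTree} → {f : Leaf t → BTree} → (a : Leaf t) → (b : Leaf (f a)) →
    (Leaf.comp a b).word = a.word ++ b.word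
  | _, _, .here, b => rfl
  | _, f, .left a, b => by
      have := Leaf.word_comp (f := fun a => f a.left) a b
      simp only [Leaf.comp, Leaf.word, this]; rfl
  | _, f, .right a, b => by
      have := Leaf.word_comp (f := fun a => f a.right) a b
      simp only [Leaf.comp, Leaf.word, this]; rfl

/-- The leaf of `t`, and the leaf of the tree attached there, of a leaf of `t.graft f`. -/
def Leaf.split : {t : BTree} → {f : Leaf t → BTree} → Leaf (t.graft f) → (a : Leaf t) × Leaf (f a)
  | .leaf, _, c => ⟨.here, c⟩
  | .caret _ _, f, .left c =>
    let p := Leaf.split (f := fun a => f a.left) c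
    ⟨p.1.left, p.2⟩
  | .caret _ _, f, .right c =>
    let p := Leaf.split (f := fun a => f a.right) c
    ⟨p.1.right, p.2⟩

theorem Leaf.split_comp : {t : BTree} → {f : Leaf t → BTree} → (a : Leaf t) → (b : Leaf (f a)) →
    Leaf.split (Leaf.comp a b) = ⟨a, b⟩
  | _, _, .here, b => rfl
  | _, f, .left a, b => by
      have := Leaf.split_comp (f := fun a => f a.left) a b
      simp only [Leaf.comp, Leaf.split]; rw [this]
  | _, f, .right a, b => by
      have := Leaf.split_comp (f := fun a => f a.right) a b
      simp only [Leaf.comp, Leaf.split]; rw [this]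

theorem Leaf.comp_split : {t : BTree} → {f : Leaf t → BTree} → (c : Leaf (t.graft f)) →
    Leaf.comp (Leaf.split c).1 (Leaf.split c).2 = c
  | .leaf, _, _ => rfl
  | .caret _ _, f, .left c => by
      exact congrArg Leaf.left (Leaf.comp_split (f := fun a => f a.left) c)
  | .caret _ _, f, .right c => by
      exact congrArg Leaf.right (Leaf.comp_split (f := fun a => f a.right) c)

/-- Sequences extending the words of two distinct leaves compare as these leaves do. -/
theorem Leaf.append_lt_append : {t : BTree} → {a b : Leaf t} → a.word < b.word →
    (u v : List Bool) → a.word ++ u < b.word ++ v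
  | _, .here, .here, h, _, _ => absurd h (lt_irrefl _)
  | _, .left a, .left b, h, u, v => by
      have := Leaf.append_lt_append (a := a) (b := b) (by simpa [Leaf.word] using h) u v
      simpa [Leaf.word] using this
  | _, .right a, .right b, h, u, v => by
      have := Leaf.append_lt_append (a := a) (b := b) (by simpa [Leaf.word] using h) u v
      simpa [Leaf.word] using this
  | _, .left a, .right b, _, u, v => by
      simp [Leaf.word, List.cons_lt_cons_iff]
  | _, .right a, .left b, h, u, v => by
      exact absurd (List.cons_lt_cons_iff.mp h) (by simp)

theorem Leaf.comp_lt_comp {t : BTree} {f : Leaf t → BTree} {a a' : Leaf t} (h : a < a')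
    (b : Leaf (f a)) (b' : Leaf (f a')) : Leaf.comp a b < Leaf.comp a' b' := by
  change (Leaf.comp a b).word < (Leaf.comp a' b').word
  rw [Leaf.word_comp, Leaf.word_comp]
  exact Leaf.append_lt_append h _ _

theorem Leaf.comp_lt_comp_right {t : BTree} {f : Leaf t → BTree} {a : Leaf t}
    {b b' : Leaf (f a)} (h : b < b') : Leaf.comp a b < Leaf.comp a b' := by
  change (Leaf.comp a b).word < (Leaf.comp a b').word
  rw [Leaf.word_comp, Leaf.word_comp]
  exact List.append_left_lt h

theorem Leaf.exists_eq_comp {t : BTree} {f : Leaf t → BTree} (c : Leaf (t.graft f)) :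
    ∃ (a : Leaf t) (b : Leaf (f a)), c = Leaf.comp a b :=
  ⟨_, _, (Leaf.comp_split c).symm⟩

/-- The map on leaves induced by a map `e` of leaves, after attaching the same forest. -/
def Leaf.refineAux {s t : BTree} (e : Leaf s → Leaf t) (f : Leaf t → BTree)
    (p : (a : Leaf s) × Leaf (f (e a))) : Leaf (t.graft f) :=
  Leaf.comp (e p.1) p.2

/-- The order isomorphism between the leaves of two trees, after attaching the same forest to
both of them. -/
noncomputable def Leaf.refine {s t : BTree} (e : Leaf s ≃o Leaf t) (f : Leaf t → BTree) :
    Leaf (s.graft fun a => f (e a)) ≃o Leaf (t.graft f) :=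
  StrictMono.orderIsoOfSurjective
    (fun c => Leaf.refineAux e f (Leaf.split c))
    (by
      intro c c' h
      obtain ⟨a, b, rfl⟩ := Leaf.exists_eq_comp c
      obtain ⟨a', b', rfl⟩ := Leaf.exists_eq_comp c'
      simp only [Leaf.split_comp]
      rcases lt_trichotomy a a' with ha | rfl | ha
      · exact Leaf.comp_lt_comp (e.strictMono ha) _ _
      · refine Leaf.comp_lt_comp_right ?_
        rcases lt_trichotomy b b' with hb | rfl | hb
        · exact hb
        · exact absurd h (lt_irrefl _)
        · exact absurd h (Leaf.comp_lt_comp_right (f := fun a => f (e a)) hb).asymm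
      · exact absurd h (Leaf.comp_lt_comp ha _ _).asymm)
    (by
      intro c
      obtain ⟨a, b, rfl⟩ := Leaf.exists_eq_comp c
      obtain ⟨a, rfl⟩ := e.surjective a
      exact ⟨Leaf.comp (f := fun a => f (e a)) a b, by
        simp only [Leaf.split_comp]; rfl⟩)

theorem Leaf.refine_comp {s t : BTree} (e : Leaf s ≃o Leaf t) (f : Leaf t → BTree) (a : Leaf s)
    (b : Leaf (f (e a))) :
    Leaf.refine e f (Leaf.comp (f := fun a => f (e a)) a b) = Leaf.comp (e a) b := by
  change Leaf.refineAux e f (Leaf.split _) = _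
  rw [Leaf.split_comp]; rfl

/-- A tree is determined by the binary sequences of its leaves. -/
theorem eq_of_word : {t s : BTree} → (∀ a : Leaf t, ∃ b : Leaf s, b.word = a.word) →
    (∀ b : Leaf s, ∃ a : Leaf t, a.word = b.word) → t = s
  | .leaf, .leaf, _, _ => rfl
  | .leaf, .caret l r, h, _ => by
      obtain ⟨b, hb⟩ := h .here
      cases b <;> simp [Leaf.word] at hb
  | .caret l r, .leaf, _, h => by
      obtain ⟨b, hb⟩ := h .here
      cases b <;> simp [Leaf.word] at hb
  | .caret l r, .caret l' r', h, k => by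
      have hl : l = l' := eq_of_word
        (fun a => by
          obtain ⟨b, hb⟩ := h a.left
          cases b with
          | left b => exact ⟨b, by simpa [Leaf.word] using hb⟩
          | right b => simp [Leaf.word] at hb)
        (fun a => by
          obtain ⟨b, hb⟩ := k a.left
          cases b with
          | left b => exact ⟨b, by simpa [Leaf.word] using hb⟩
          | right b => simp [Leaf.word] at hb)
      have hr : r = r' := eq_of_word
        (fun a => by
          obtain ⟨b, hb⟩ := h a.right
          cases b with
          | right b => exact ⟨b, by simpa [Leaf.word] using hb⟩
          | left b => simp [Leaf.word] at hb)
        (fun a => by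
          obtain ⟨b, hb⟩ := k a.right
          cases b with
          | right b => exact ⟨b, by simpa [Leaf.word] using hb⟩
          | left b => simp [Leaf.word] at hb)
      rw [hl, hr]

end BTree

/-! ### Thompson's group `F` -/

/-- The Cantor space of infinite binary sequences. -/
abbrev CantorSeq : Type := ℕ → Bool

/-- The concatenation `w · x` of a finite and an infinite binary sequence. -/
def prepend : List Bool → CantorSeq → CantorSeq
  | [], x, n => x n
  | b :: _, _, 0 => b
  | _ :: w, x, n + 1 => prepend w x n

theorem prepend_append : (v w : List Bool) → (x : CantorSeq) →
    prepend (v ++ w) x = prepend v (prepend w x)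
  | [], _, _ => rfl
  | b :: v, w, x => by
      funext n
      cases n with
      | zero => rfl
      | succ n => exact congrFun (prepend_append v w x) n

theorem prepend_injective : {v w : List Bool} → (∀ x, prepend v x = prepend w x) → v = w
  | [], [], _ => rfl
  | [], b :: w, h => by
      have := congrFun (h fun _ => !b) 0
      simp [prepend] at this
  | b :: w, [], h => by
      have := congrFun (h fun _ => !b) 0
      simp [prepend] at this
  | b :: v, c :: w, h => by
      have h0 : b = c := congrFun (h fun _ => false) 0
      have h1 : v = w := prepend_injective fun x => funext fun n => congrFun (h x) (n + 1)
      rw [h0, h1]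

/-- The homeomorphism `g` of the Cantor space is described by the trees `t`, `s` with the same
number of leaves (written `[t, s]`): `g (v · x) = w · x` for all infinite sequences `x`, whenever
`v` is the `k`-th leaf of `s` and `w` is the `k`-th leaf of `t`, in the order from left to right.
Here `e` is the order-preserving bijection from the leaves of `s` to those of `t`. -/
def IsTreeDiagram (g : CantorSeq ≃ₜ CantorSeq) (t s : BTree) (e : s.Leaf ≃o t.Leaf) : Prop :=
  ∀ (a : s.Leaf) (x : CantorSeq), g (prepend a.word x) = prepend (e a).word x

namespace IsTreeDiagram

variable {g h : CantorSeq ≃ₜ CantorSeq} {t s r : BTree}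

theorem one (t : BTree) : IsTreeDiagram 1 t t (OrderIso.refl _) := fun _ _ => rfl

theorem symm {e : s.Leaf ≃o t.Leaf} (hg : IsTreeDiagram g t s e) :
    IsTreeDiagram g⁻¹ s t e.symm := fun a x => by
  change g.symm _ = _
  rw [Homeomorph.symm_apply_eq, hg, e.apply_symm_apply]

theorem mul {e : s.Leaf ≃o t.Leaf} {e' : r.Leaf ≃o s.Leaf} (hg : IsTreeDiagram g t s e)
    (hh : IsTreeDiagram h s r e') : IsTreeDiagram (g * h) t r (e'.trans e) := fun a x => by
  change g (h _) = _
  rw [hh, hg]; rfl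

/-- Attaching a forest to both trees does not change the homeomorphism. -/
theorem graft {e : s.Leaf ≃o t.Leaf} (hg : IsTreeDiagram g t s e) (f : t.Leaf → BTree) :
    IsTreeDiagram g (t.graft f) (s.graft fun a => f (e a)) (BTree.Leaf.refine e f) :=
  fun c x => by
    obtain ⟨a, b, rfl⟩ := BTree.Leaf.exists_eq_comp c
    rw [BTree.Leaf.refine_comp, BTree.Leaf.word_comp, BTree.Leaf.word_comp, prepend_append,
      prepend_append, hg]

theorem exists_target {e : s.Leaf ≃o t.Leaf} (hg : IsTreeDiagram g t s e) {t' : BTree}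
    (ht : t ≤ t') : ∃ (s' : BTree) (_ : s ≤ s') (e' : s'.Leaf ≃o t'.Leaf),
      IsTreeDiagram g t' s' e' := by
  obtain ⟨f, rfl⟩ := BTree.exists_eq_graft ht
  exact ⟨_, BTree.le_graft _ _, _, hg.graft f⟩

theorem exists_source {e : s.Leaf ≃o t.Leaf} (hg : IsTreeDiagram g t s e) {s' : BTree}
    (hs : s ≤ s') : ∃ (t' : BTree) (_ : t ≤ t') (e' : s'.Leaf ≃o t'.Leaf),
      IsTreeDiagram g t' s' e' := by
  obtain ⟨t', ht, e', h'⟩ := hg.symm.exists_target hs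
  exact ⟨t', ht, e'.symm, by simpa using h'.symm⟩

theorem word_eq {t' : BTree} {e : s.Leaf ≃o t.Leaf} {e' : s.Leaf ≃o t'.Leaf}
    (hg : IsTreeDiagram g t s e) (hg' : IsTreeDiagram g t' s e') (a : s.Leaf) :
    (e a).word = (e' a).word :=
  prepend_injective fun x => by rw [← hg, ← hg']

theorem target_unique {t' : BTree} {e : s.Leaf ≃o t.Leaf} {e' : s.Leaf ≃o t'.Leaf}
    (hg : IsTreeDiagram g t s e) (hg' : IsTreeDiagram g t' s e') : t = t' :=
  BTree.eq_of_word
    (fun a => ⟨e' (e.symm a), by rw [← hg.word_eq hg', e.apply_symm_apply]⟩)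
    (fun a => ⟨e (e'.symm a), by rw [hg.word_eq hg', e'.apply_symm_apply]⟩)

end IsTreeDiagram

/-- Thompson's group `F`, acting on the Cantor space: the homeomorphisms described by a pair of
trees with the same number of leaves. -/
def ThompsonF : Subgroup (CantorSeq ≃ₜ CantorSeq) where
  carrier := {g | ∃ (t s : BTree) (e : s.Leaf ≃o t.Leaf), IsTreeDiagram g t s e}
  one_mem' := ⟨.leaf, .leaf, _, IsTreeDiagram.one _⟩
  inv_mem' := fun ⟨_, _, _, h⟩ => ⟨_, _, _, h.symm⟩
  mul_mem' := by
    rintro g h ⟨t, s, e, hg⟩ ⟨t', s', e', hh⟩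
    obtain ⟨r, hr, hr'⟩ := exists_ge_ge s t'
    obtain ⟨_, _, _, hg⟩ := hg.exists_source hr
    obtain ⟨_, _, _, hh⟩ := hh.exists_target hr'
    exact ⟨_, _, _, hg.mul hh⟩

/-! ### The limit space of a Pythagorean pair -/

/-- A Pythagorean pair over a Hilbert space: bounded operators `A`, `B` with
`A* A + B* B = id`. -/
structure PythagoreanPair (H : Type*) [NormedAddCommGroup H] [InnerProductSpace ℂ H]
    [CompleteSpace H] where
  A : H →L[ℂ] H
  B : H →L[ℂ] H
  adjoint_mul_add : ContinuousLinearMap.adjoint A ∘L A + ContinuousLinearMap.adjoint B ∘L B =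
    ContinuousLinearMap.id ℂ H

/-- The Hilbert space `ℓ²(Leaf(t), H)` of decorations of the leaves of the tree `t` with vectors
of `H`. -/
abbrev Decoration (H : Type*) [NormedAddCommGroup H] [InnerProductSpace ℂ H] (t : BTree) : Type _ :=
  PiLp 2 fun _ : t.Leaf => H

/-- Moving a decoration of the leaves of `s` to the leaves of `t` along an order-preserving
bijection: the decoration of the `k`-th leaf of `s` becomes that of the `k`-th leaf of `t`. -/
noncomputable def Decoration.relabel (H : Type*) [NormedAddCommGroup H] [InnerProductSpace ℂ H]
    {s t : BTree} (e : s.Leaf ≃o t.Leaf) : Decoration H s ≃ₗᵢ[ℂ] Decoration H t :=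
  LinearIsometryEquiv.piLpCongrLeft 2 ℂ H e.toEquiv

theorem Decoration.relabel_apply {H : Type*} [NormedAddCommGroup H] [InnerProductSpace ℂ H]
    {s t : BTree} (e : s.Leaf ≃o t.Leaf) (ξ : Decoration H s) (a : t.Leaf) :
    Decoration.relabel H e ξ a = ξ (e.symm a) := rfl

namespace PythagoreanPair

open Decoration

variable {H : Type*} [NormedAddCommGroup H] [InnerProductSpace ℂ H] [CompleteSpace H]

theorem inner_add_inner (P : PythagoreanPair H) (v w : H) :
    inner ℂ (P.A v) (P.A w) + inner ℂ (P.B v) (P.B w) = inner ℂ v w := by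
  have h := congrArg (fun T : H →L[ℂ] H => inner ℂ v (T w)) P.adjoint_mul_add
  simpa [inner_add_right, ContinuousLinearMap.adjoint_inner_right] using h

/-- Growing a decorated tree: `ξ` decorates the leaves of `t`, which is a rooted subtree of `s`.
Each time a caret is added at a leaf decorated by `v`, its left and right leaves are decorated by
`A v` and `B v`, until the tree `s` is reached. -/
def grow (P : PythagoreanPair H) : {t s : BTree} → t.IsSubtree s → (t.Leaf → H) → s.Leaf → H
  | .leaf, .leaf, _, ξ, _ => ξ .here
  | .leaf, .caret l _, _, ξ, .left a => P.grow (t := .leaf) (s := l) trivial (fun b => P.A (ξ b)) a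
  | .leaf, .caret _ r, _, ξ, .right a => P.grow (t := .leaf) (s := r) trivial (fun b => P.B (ξ b)) a
  | .caret l _, .caret l' _, h, ξ, .left a =>
      P.grow (t := l) (s := l') h.1 (fun b => ξ b.left) a
  | .caret _ r, .caret _ r', h, ξ, .right a =>
      P.grow (t := r) (s := r') h.2 (fun b => ξ b.right) a

theorem grow_refl (P : PythagoreanPair H) : {t : BTree} → (h : t.IsSubtree t) → (ξ : t.Leaf → H) →
    (a : t.Leaf) → P.grow h ξ a = ξ a
  | _, _, _, .here => by simp only [grow]
  | _, h, ξ, .left a => by simp only [grow]; exact P.grow_refl h.1 _ a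
  | _, h, ξ, .right a => by simp only [grow]; exact P.grow_refl h.2 _ a

theorem grow_add (P : PythagoreanPair H) : {t s : BTree} → (h : t.IsSubtree s) →
    (ξ η : t.Leaf → H) → (a : s.Leaf) →
    P.grow h (fun b => ξ b + η b) a = P.grow h ξ a + P.grow h η a
  | .leaf, .leaf, _, _, _, _ => by simp only [grow]
  | .leaf, .caret l r, h, ξ, η, .left a => by simp only [grow, map_add]; exact P.grow_add _ _ _ a
  | .leaf, .caret l r, h, ξ, η, .right a => by simp only [grow, map_add]; exact P.grow_add _ _ _ a
  | .caret l r, .caret l' r', h, ξ, η, .left a => by simp only [grow]; exact P.grow_add _ _ _ a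
  | .caret l r, .caret l' r', h, ξ, η, .right a => by simp only [grow]; exact P.grow_add _ _ _ a

theorem grow_smul (P : PythagoreanPair H) (c : ℂ) : {t s : BTree} → (h : t.IsSubtree s) →
    (ξ : t.Leaf → H) → (a : s.Leaf) → P.grow h (fun b => c • ξ b) a = c • P.grow h ξ a
  | .leaf, .leaf, _, _, _ => by simp only [grow]
  | .leaf, .caret l r, h, ξ, .left a => by simp only [grow, map_smul]; exact P.grow_smul c _ _ a
  | .leaf, .caret l r, h, ξ, .right a => by simp only [grow, map_smul]; exact P.grow_smul c _ _ a
  | .caret l r, .caret l' r', h, ξ, .left a => by simp only [grow]; exact P.grow_smul c _ _ a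
  | .caret l r, .caret l' r', h, ξ, .right a => by simp only [grow]; exact P.grow_smul c _ _ a

theorem grow_trans (P : PythagoreanPair H) : {t s r : BTree} → (h : t.IsSubtree s) →
    (k : s.IsSubtree r) → (m : t.IsSubtree r) → (ξ : t.Leaf → H) → (a : r.Leaf) →
    P.grow k (P.grow h ξ) a = P.grow m ξ a
  | .leaf, .leaf, .leaf, _, _, _, _, _ => by simp only [grow]
  | .leaf, .leaf, .caret l r, h, k, m, ξ, .left a => by
      simp only [grow]
      congr 1; funext b; cases b; rfl
  | .leaf, .leaf, .caret l r, h, k, m, ξ, .right a => by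
      simp only [grow]
      congr 1; funext b; cases b; rfl
  | .leaf, .caret l r, .caret l' r', h, k, m, ξ, .left a => by
      simp only [grow]; exact P.grow_trans _ k.1 _ _ a
  | .leaf, .caret l r, .caret l' r', h, k, m, ξ, .right a => by
      simp only [grow]; exact P.grow_trans _ k.2 _ _ a
  | .caret _ _, .caret _ _, .caret _ _, h, k, m, ξ, .left a => by
      simp only [grow]; exact P.grow_trans _ k.1 _ _ a
  | .caret _ _, .caret _ _, .caret _ _, h, k, m, ξ, .right a => by
      simp only [grow]; exact P.grow_trans _ k.2 _ _ a

theorem sum_leaf (f : BTree.Leaf .leaf → ℂ) : ∑ a, f a = f .here := by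
  rw [← BTree.leafEquivUnit.symm.sum_comp]
  simp [BTree.leafEquivUnit]

theorem sum_caret {l r : BTree} (f : BTree.Leaf (.caret l r) → ℂ) :
    ∑ a, f a = ∑ a : l.Leaf, f a.left + ∑ a : r.Leaf, f a.right := by
  rw [← (BTree.leafEquivSum l r).symm.sum_comp, Fintype.sum_sum_type]
  rfl

theorem grow_inner (P : PythagoreanPair H) : {t s : BTree} → (h : t.IsSubtree s) →
    (ξ η : t.Leaf → H) →
    ∑ a, inner ℂ (P.grow h ξ a) (P.grow h η a) = ∑ b, inner ℂ (ξ b) (η b)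
  | .leaf, .leaf, _, ξ, η => by simp only [sum_leaf, grow]
  | .leaf, .caret l r, _, ξ, η => by
      have hl := P.grow_inner (t := .leaf) (s := l) trivial (fun b => P.A (ξ b)) fun b => P.A (η b)
      have hr := P.grow_inner (t := .leaf) (s := r) trivial (fun b => P.B (ξ b)) fun b => P.B (η b)
      rw [sum_caret]
      simp only [grow]
      rw [hl, hr]
      simp only [sum_leaf, P.inner_add_inner]
  | .caret l r, .caret l' r', h, ξ, η => by
      have hl := P.grow_inner (t := l) (s := l') h.1 (fun b => ξ b.left) fun b => η b.left
      have hr := P.grow_inner (t := r) (s := r') h.2 (fun b => ξ b.right) fun b => η b.right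
      rw [sum_caret, sum_caret]
      simp only [grow]
      rw [hl, hr]

/-- Growing along a forest: the leaf `Leaf.comp a b` receives the decoration obtained by growing,
from the single leaf `a`, the tree attached there. -/
theorem grow_comp (P : PythagoreanPair H) : {t : BTree} → {f : t.Leaf → BTree} →
    (h : t.IsSubtree (t.graft f)) → (ξ : t.Leaf → H) → (a : t.Leaf) → (b : (f a).Leaf) →
    P.grow h ξ (BTree.Leaf.comp a b) = P.grow (t := .leaf) (s := f a) trivial (fun _ => ξ a) b
  | _, f, h, ξ, .here, b => by
      congr 1; funext b; cases b; rfl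
  | _, f, h, ξ, .left a, b => P.grow_comp (f := fun a => f a.left) h.1 (fun b => ξ b.left) a b
  | _, f, h, ξ, .right a, b => P.grow_comp (f := fun a => f a.right) h.2 (fun b => ξ b.right) a b

/-- The connecting isometry from the decorations of `t` to the decorations of `s`, for `t ≤ s`. -/
noncomputable def connect (P : PythagoreanPair H) {t s : BTree} (h : t ≤ s) :
    Decoration H t →ₗᵢ[ℂ] Decoration H s :=
  LinearMap.isometryOfInner
    { toFun := fun ξ => WithLp.toLp 2 (P.grow h ξ)
      map_add' := fun ξ η => by ext a; exact P.grow_add h ξ η a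
      map_smul' := fun c ξ => by ext a; exact P.grow_smul c h ξ a }
    fun ξ η => by
      rw [PiLp.inner_apply, PiLp.inner_apply]
      exact P.grow_inner h ξ η

theorem connect_apply (P : PythagoreanPair H) {t s : BTree} (h : t ≤ s) (ξ : Decoration H t)
    (a : s.Leaf) : P.connect h ξ a = P.grow h ξ a := rfl

instance (P : PythagoreanPair H) :
    DirectedSystem (Decoration H) fun _ _ h => ⇑(P.connect h) where
  map_self _ ξ := by ext a; exact P.grow_refl _ ξ a
  map_map _ _ _ h k ξ := by ext a; exact P.grow_trans h k _ ξ a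

/-- The direct limit of the Hilbert spaces of decorated trees along the connecting isometries. -/
def PreLimit (P : PythagoreanPair H) : Type _ :=
  DirectLimit (Decoration H) fun _ _ h => P.connect h

noncomputable instance (P : PythagoreanPair H) : AddCommGroup P.PreLimit :=
  inferInstanceAs (AddCommGroup (DirectLimit (Decoration H) fun _ _ h => P.connect h))

noncomputable instance (P : PythagoreanPair H) : Module ℂ P.PreLimit :=
  inferInstanceAs (Module ℂ (DirectLimit (Decoration H) fun _ _ h => P.connect h))

/-- The class `[t, ξ]` of the tree `t` with leaves decorated by `ξ`. -/
noncomputable def cls (P : PythagoreanPair H) (t : BTree) (ξ : Decoration H t) : P.PreLimit := ⟦⟨t, ξ⟩⟧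

theorem cls_connect (P : PythagoreanPair H) {t s : BTree} (h : t ≤ s) (ξ : Decoration H t) :
    P.cls s (P.connect h ξ) = P.cls t ξ :=
  DirectLimit.mk_apply (f := fun _ _ h => P.connect h) t s ξ h

theorem cls_eq_cls (P : PythagoreanPair H) {t s : BTree} {ξ : Decoration H t} {η : Decoration H s}
    (h : P.cls t ξ = P.cls s η) :
    ∃ (r : BTree) (h : t ≤ r) (k : s ≤ r), P.connect h ξ = P.connect k η :=
  Quotient.exact h

theorem cls_add (P : PythagoreanPair H) {t : BTree} (ξ η : Decoration H t) :
    P.cls t (ξ + η) = P.cls t ξ + P.cls t η :=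
  (DirectLimit.add_def (f := fun _ _ h => P.connect h) t ξ η).symm

theorem cls_smul (P : PythagoreanPair H) {t : BTree} (c : ℂ) (ξ : Decoration H t) :
    P.cls t (c • ξ) = c • P.cls t ξ :=
  (DirectLimit.smul_def (f := fun _ _ h => P.connect h) t ξ c).symm

theorem cls_zero (P : PythagoreanPair H) (t : BTree) : P.cls t 0 = 0 :=
  (DirectLimit.zero_def (f := fun _ _ h => P.connect h) t).symm

@[elab_as_elim]
theorem induction₁ (P : PythagoreanPair H) {C : P.PreLimit → Prop}
    (h : ∀ t ξ, C (P.cls t ξ)) (x : P.PreLimit) : C x :=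
  DirectLimit.induction (f := fun _ _ h => P.connect h) h x

@[elab_as_elim]
theorem induction₂ (P : PythagoreanPair H) {C : P.PreLimit → P.PreLimit → Prop}
    (h : ∀ t ξ η, C (P.cls t ξ) (P.cls t η)) (x y : P.PreLimit) : C x y :=
  DirectLimit.induction₂ (f := fun _ _ h => P.connect h) h x y

@[elab_as_elim]
theorem induction₃ (P : PythagoreanPair H) {C : P.PreLimit → P.PreLimit → P.PreLimit → Prop}
    (h : ∀ t ξ η ζ, C (P.cls t ξ) (P.cls t η) (P.cls t ζ)) (x y z : P.PreLimit) : C x y z :=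
  DirectLimit.induction₃ (f := fun _ _ h => P.connect h) h x y z

/-- The inner product of the direct limit: `⟨[t, ξ], [t, η]⟩ = ⟨ξ, η⟩`. -/
noncomputable def preInner (P : PythagoreanPair H) (x y : P.PreLimit) : ℂ :=
  DirectLimit.lift₂ (fun _ _ h => P.connect h) (fun _ _ h => P.connect h)
    (fun _ ξ η => inner ℂ ξ η) (fun _ _ h ξ η => ((P.connect h).inner_map_map ξ η).symm) x y

theorem preInner_cls (P : PythagoreanPair H) (t : BTree) (ξ η : Decoration H t) :
    P.preInner (P.cls t ξ) (P.cls t η) = inner ℂ ξ η :=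
  DirectLimit.lift₂_def _ _ _ _ t ξ η

noncomputable instance core (P : PythagoreanPair H) : InnerProductSpace.Core ℂ P.PreLimit where
  inner := P.preInner
  conj_inner_symm := P.induction₂ fun t ξ η => by
    rw [preInner_cls, preInner_cls, inner_conj_symm]
  re_inner_nonneg := P.induction₁ fun t ξ => by
    rw [preInner_cls]; exact inner_self_nonneg
  add_left := P.induction₃ fun t ξ η ζ => by
    rw [← cls_add, preInner_cls, preInner_cls, preInner_cls, inner_add_left]
  smul_left x y c := by
    refine P.induction₂ (fun t ξ η => ?_) x y
    rw [← cls_smul, preInner_cls, preInner_cls, inner_smul_left]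
  definite := P.induction₁ fun t ξ h => by
    rw [preInner_cls, inner_self_eq_zero] at h
    rw [h, cls_zero]

noncomputable instance (P : PythagoreanPair H) : NormedAddCommGroup P.PreLimit :=
  P.core.toNormedAddCommGroup

noncomputable instance (P : PythagoreanPair H) : InnerProductSpace ℂ P.PreLimit :=
  InnerProductSpace.ofCore P.core.toCore

theorem inner_cls (P : PythagoreanPair H) (t : BTree) (ξ η : Decoration H t) :
    inner ℂ (P.cls t ξ) (P.cls t η) = inner ℂ ξ η :=
  P.preInner_cls t ξ η

/-- The Hilbert space of the Pythagorean representation: the completion of the direct limit. -/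
abbrev Limit (P : PythagoreanPair H) : Type _ := UniformSpace.Completion P.PreLimit

/-! ### The Jones action of `F` -/

theorem exists_relabel_connect (P : PythagoreanPair H) {g : CantorSeq ≃ₜ CantorSeq} {t s r : BTree}
    {e : s.Leaf ≃o t.Leaf} (hg : IsTreeDiagram g t s e) (h : s ≤ r) :
    ∃ (u : BTree) (k : t ≤ u) (e' : r.Leaf ≃o u.Leaf), IsTreeDiagram g u r e' ∧
      ∀ ξ, relabel H e' (P.connect h ξ) = P.connect k (relabel H e ξ) := by
  obtain ⟨f, rfl⟩ := BTree.exists_eq_graft h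
  refine ⟨_, BTree.le_graft _ fun a => f (e.symm a), (BTree.Leaf.refine e.symm f).symm,
    by simpa using (hg.symm.graft f).symm, fun ξ => ?_⟩
  ext c
  obtain ⟨a, b, rfl⟩ := BTree.Leaf.exists_eq_comp c
  rw [relabel_apply, OrderIso.symm_symm, BTree.Leaf.refine_comp, connect_apply, connect_apply]
  erw [P.grow_comp, P.grow_comp]
  rfl

theorem cls_relabel_eq (P : PythagoreanPair H) {g : CantorSeq ≃ₜ CantorSeq} {t s t' s' : BTree}
    {e : s.Leaf ≃o t.Leaf} {e' : s'.Leaf ≃o t'.Leaf} (hg : IsTreeDiagram g t s e)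
    (hg' : IsTreeDiagram g t' s' e') {ξ : Decoration H s} {ξ' : Decoration H s'}
    (h : P.cls s ξ = P.cls s' ξ') :
    P.cls t (relabel H e ξ) = P.cls t' (relabel H e' ξ') := by
  obtain ⟨r, hr, hr', h⟩ := P.cls_eq_cls h
  obtain ⟨u, k, d, hd, hξ⟩ := P.exists_relabel_connect hg hr
  obtain ⟨u', k', d', hd', hξ'⟩ := P.exists_relabel_connect hg' hr'
  obtain rfl := hd.target_unique hd'
  obtain rfl : d = d' := by
    ext a; exact BTree.Leaf.word_injective (hd.word_eq hd' a)
  rw [← P.cls_connect k, ← P.cls_connect k', ← hξ, ← hξ', h]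

theorem exists_diagram (g : ThompsonF) (s : BTree) : ∃ (r : BTree) (_ : s ≤ r) (u : BTree)
    (e : r.Leaf ≃o u.Leaf), IsTreeDiagram g.1 u r e := by
  obtain ⟨t, r, e, hg⟩ := g.2
  obtain ⟨r', h, h'⟩ := exists_ge_ge r s
  obtain ⟨u, _, e', hg'⟩ := hg.exists_source h
  exact ⟨r', h', u, e', hg'⟩

/-- The Jones action on the direct limit, `σ(g) [s, ξ] = [t, ξ]` for `g = [t, s]`
(see `act_cls`): representatives with a common tree `s` are chosen. -/
noncomputable def act (P : PythagoreanPair H) (g : ThompsonF) (x : P.PreLimit) : P.PreLimit :=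
  DirectLimit.lift (fun _ _ h => P.connect h)
    (fun s ξ => P.cls (exists_diagram g s).choose_spec.choose_spec.choose
      (relabel H (exists_diagram g s).choose_spec.choose_spec.choose_spec.choose
        (P.connect (exists_diagram g s).choose_spec.choose ξ)))
    (fun s t h ξ => P.cls_relabel_eq
      (exists_diagram g s).choose_spec.choose_spec.choose_spec.choose_spec
      (exists_diagram g t).choose_spec.choose_spec.choose_spec.choose_spec
      (by rw [cls_connect, cls_connect, cls_connect])) x

/-- The formula `σ([t, s]) [s, ξ] = [t, ξ]`. -/
theorem act_cls (P : PythagoreanPair H) {g : ThompsonF} {t s : BTree} {e : s.Leaf ≃o t.Leaf}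
    (hg : IsTreeDiagram g.1 t s e) (ξ : Decoration H s) :
    P.act g (P.cls s ξ) = P.cls t (relabel H e ξ) :=
  P.cls_relabel_eq (exists_diagram g s).choose_spec.choose_spec.choose_spec.choose_spec hg
    (P.cls_connect _ _)

theorem exists_cls (P : PythagoreanPair H) (g : ThompsonF) (x : P.PreLimit) :
    ∃ (t s : BTree) (e : s.Leaf ≃o t.Leaf) (ξ : Decoration H s),
      IsTreeDiagram g.1 t s e ∧ x = P.cls s ξ := by
  refine P.induction₁ (fun s ξ => ?_) x
  obtain ⟨r, h, u, e, hg⟩ := exists_diagram g s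
  exact ⟨u, r, e, P.connect h ξ, hg, (P.cls_connect h ξ).symm⟩

theorem exists_cls₂ (P : PythagoreanPair H) (g : ThompsonF) (x y : P.PreLimit) :
    ∃ (t s : BTree) (e : s.Leaf ≃o t.Leaf) (ξ η : Decoration H s),
      IsTreeDiagram g.1 t s e ∧ x = P.cls s ξ ∧ y = P.cls s η := by
  refine P.induction₂ (fun s ξ η => ?_) x y
  obtain ⟨r, h, u, e, hg⟩ := exists_diagram g s
  exact ⟨u, r, e, P.connect h ξ, P.connect h η, hg, (P.cls_connect h ξ).symm,
    (P.cls_connect h η).symm⟩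

theorem act_one (P : PythagoreanPair H) (x : P.PreLimit) : P.act 1 x = x := by
  refine P.induction₁ (fun s ξ => ?_) x
  rw [P.act_cls (g := 1) (IsTreeDiagram.one s)]; rfl

theorem act_mul (P : PythagoreanPair H) (g h : ThompsonF) (x : P.PreLimit) :
    P.act (g * h) x = P.act g (P.act h x) := by
  obtain ⟨t, s, e, ξ, hh, rfl⟩ := P.exists_cls h x
  obtain ⟨r, k, u, d, hg⟩ := exists_diagram g t
  obtain ⟨s', k', e', hh'⟩ := hh.exists_target k
  rw [← P.cls_connect k', P.act_cls hh', P.act_cls hg, P.act_cls (g := g * h) (hg.mul hh')]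
  rfl

/-- The Jones action of an element of `F` on the direct limit, as a linear isometry. -/
noncomputable def actIsometry (P : PythagoreanPair H) (g : ThompsonF) :
    P.PreLimit →ₗᵢ[ℂ] P.PreLimit :=
  LinearMap.isometryOfInner
    { toFun := P.act g
      map_add' := fun x y => by
        obtain ⟨t, s, e, ξ, η, hg, rfl, rfl⟩ := P.exists_cls₂ g x y
        rw [← cls_add, P.act_cls hg, P.act_cls hg, P.act_cls hg, map_add, cls_add]
      map_smul' := fun c x => by
        obtain ⟨t, s, e, ξ, hg, rfl⟩ := P.exists_cls g x
        rw [← cls_smul, P.act_cls hg, P.act_cls hg, map_smul, cls_smul]; rfl }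
    fun x y => by
      obtain ⟨t, s, e, ξ, η, hg, rfl, rfl⟩ := P.exists_cls₂ g x y
      change inner ℂ (P.act g (P.cls s ξ)) (P.act g (P.cls s η)) = _
      rw [P.act_cls hg, P.act_cls hg, inner_cls, inner_cls, LinearIsometryEquiv.inner_map_map]

theorem actIsometry_apply (P : PythagoreanPair H) (g : ThompsonF) (x : P.PreLimit) :
    P.actIsometry g x = P.act g x := rfl

/-- The continuous extension of the Jones action of an element of `F` to the limit space. -/
noncomputable def actLimit (P : PythagoreanPair H) (g : ThompsonF) : P.Limit →L[ℂ] P.Limit :=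
  (P.actIsometry g).toContinuousLinearMap.completion

theorem actLimit_coe (P : PythagoreanPair H) (g : ThompsonF) (x : P.PreLimit) :
    P.actLimit g (x : P.Limit) = (P.act g x : P.PreLimit) :=
  ContinuousLinearMap.completion_apply_coe _ _

theorem actLimit_one (P : PythagoreanPair H) (x : P.Limit) : P.actLimit 1 x = x := by
  induction x using UniformSpace.Completion.induction_on with
  | hp => exact isClosed_eq (P.actLimit 1).continuous continuous_id
  | ih x => rw [actLimit_coe, act_one]

theorem actLimit_mul (P : PythagoreanPair H) (g h : ThompsonF) (x : P.Limit) :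
    P.actLimit (g * h) x = P.actLimit g (P.actLimit h x) := by
  induction x using UniformSpace.Completion.induction_on with
  | hp =>
    have hc := (P.actLimit g).continuous.comp (P.actLimit h).continuous
    exact isClosed_eq (P.actLimit (g * h)).continuous hc
  | ih x => rw [actLimit_coe, actLimit_coe, actLimit_coe, act_mul]

theorem norm_actLimit (P : PythagoreanPair H) (g : ThompsonF) (x : P.Limit) :
    ‖P.actLimit g x‖ = ‖x‖ := by
  induction x using UniformSpace.Completion.induction_on with
  | hp => exact isClosed_eq (P.actLimit g).continuous.norm continuous_norm
  | ih x =>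
    rw [actLimit_coe, UniformSpace.Completion.norm_coe, UniformSpace.Completion.norm_coe,
      ← actIsometry_apply, LinearIsometry.norm_map]

end PythagoreanPair

/-! ### Unitary representations -/

/-- A unitary representation of a discrete group `G` on an inner product space `V`. -/
abbrev UnitaryRep (G V : Type*) [Group G] [NormedAddCommGroup V] [InnerProductSpace ℂ V] : Type _ :=
  G →* (V ≃ₗᵢ[ℂ] V)

/-- The Pythagorean (Jones) representation of Thompson's group `F` associated to a Pythagorean
pair. -/
noncomputable def PythagoreanPair.rep {H : Type*} [NormedAddCommGroup H] [InnerProductSpace ℂ H]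
    [CompleteSpace H] (P : PythagoreanPair H) : UnitaryRep ThompsonF P.Limit where
  toFun g :=
    { toFun := P.actLimit g
      invFun := P.actLimit g⁻¹
      map_add' := map_add _
      map_smul' := map_smul _
      left_inv := fun x => by rw [← P.actLimit_mul, inv_mul_cancel, P.actLimit_one]
      right_inv := fun x => by rw [← P.actLimit_mul, mul_inv_cancel, P.actLimit_one]
      norm_map' := P.norm_actLimit g }
  map_one' := by ext x; exact P.actLimit_one x
  map_mul' g h := by ext x; exact P.actLimit_mul g h x

/-- The defining formula `σ([t, s]) [s, ξ] = [t, ξ]` of the Pythagorean representation. -/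
theorem PythagoreanPair.rep_cls {H : Type*} [NormedAddCommGroup H] [InnerProductSpace ℂ H]
    [CompleteSpace H] (P : PythagoreanPair H) {g : ThompsonF} {t s : BTree}
    {e : s.Leaf ≃o t.Leaf} (hg : IsTreeDiagram g.1 t s e) (ξ : Decoration H s) :
    P.rep g (P.cls s ξ : P.Limit) = (P.cls t (Decoration.relabel H e ξ) : P.PreLimit) := by
  rw [← P.act_cls hg]
  exact P.actLimit_coe g _

namespace UnitaryRep

variable {G V W : Type*} [Group G] [NormedAddCommGroup V] [InnerProductSpace ℂ V]
  [NormedAddCommGroup W] [InnerProductSpace ℂ W]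

/-- With `q.out` the fixed representative of a coset `q`, the element `β(g, q)` of `K` such that
`g * q.out = (g • q).out * β(g, q)`. -/
noncomputable def cocycle (K : Subgroup G) (g : G) (q : G ⧸ K) : K :=
  ⟨(g • q).out⁻¹ * (g * q.out), by
    rw [← QuotientGroup.eq, QuotientGroup.out_eq', ← smul_eq_mul, ← MulAction.Quotient.smul_coe,
      QuotientGroup.out_eq']⟩

theorem mul_out (K : Subgroup G) (g : G) (q : G ⧸ K) :
    g * q.out = (g • q).out * cocycle K g q := by
  simp [cocycle]

theorem cocycle_one (K : Subgroup G) (q : G ⧸ K) : cocycle K 1 q = 1 := by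
  ext; simp [cocycle]

theorem cocycle_mul (K : Subgroup G) (g h : G) (q : G ⧸ K) :
    cocycle K (g * h) q = cocycle K g (h • q) * cocycle K h q := by
  ext; simp [cocycle, mul_smul, mul_assoc]

/-- The underlying formula of the induced representation,
`(Ind θ)(g) f (q) = θ(β(g⁻¹, q)⁻¹) (f (g⁻¹ • q))`. -/
noncomputable def inducedFun {K : Subgroup G} (θ : UnitaryRep K W) (g : G)
    (f : lp (fun _ : G ⧸ K => W) 2) : lp (fun _ : G ⧸ K => W) 2 :=
  ⟨fun q => θ (cocycle K g⁻¹ q)⁻¹ (f (g⁻¹ • q)), by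
    refine memℓp_gen ?_
    simp only [LinearIsometryEquiv.norm_map]
    exact ((lp.memℓp f).summable (by norm_num)).comp_injective (MulAction.injective g⁻¹)⟩

theorem inducedFun_apply {K : Subgroup G} (θ : UnitaryRep K W) (g : G)
    (f : lp (fun _ : G ⧸ K => W) 2) (q : G ⧸ K) :
    inducedFun θ g f q = θ (cocycle K g⁻¹ q)⁻¹ (f (g⁻¹ • q)) := rfl

theorem inducedFun_one {K : Subgroup G} (θ : UnitaryRep K W) (f : lp (fun _ : G ⧸ K => W) 2) :
    inducedFun θ 1 f = f := by
  ext q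
  rw [inducedFun_apply, inv_one, cocycle_one, inv_one, map_one, one_smul]; rfl

theorem inducedFun_mul {K : Subgroup G} (θ : UnitaryRep K W) (g h : G)
    (f : lp (fun _ : G ⧸ K => W) 2) :
    inducedFun θ (g * h) f = inducedFun θ g (inducedFun θ h f) := by
  ext q
  rw [inducedFun_apply, inducedFun_apply, inducedFun_apply, mul_inv_rev, cocycle_mul, mul_inv_rev,
    map_mul, mul_smul]
  rfl

/-- The representation of `G` on `ℓ²(G/K, W)` induced by a representation `θ` of the subgroup `K`
on `W`. -/
noncomputable def induced {K : Subgroup G} (θ : UnitaryRep K W) :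
    UnitaryRep G (lp (fun _ : G ⧸ K => W) 2) where
  toFun g :=
    { toFun := inducedFun θ g
      invFun := inducedFun θ g⁻¹
      map_add' := fun f f' => by
        ext q
        exact map_add (θ (cocycle K g⁻¹ q)⁻¹) _ _
      map_smul' := fun c f => by
        ext q
        exact map_smul (θ (cocycle K g⁻¹ q)⁻¹) c _
      left_inv := fun f => by rw [← inducedFun_mul, inv_mul_cancel, inducedFun_one]
      right_inv := fun f => by rw [← inducedFun_mul, mul_inv_cancel, inducedFun_one]
      norm_map' := fun f => by
        change ‖inducedFun θ g f‖ = ‖f‖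
        rw [lp.norm_eq_tsum_rpow (by norm_num), lp.norm_eq_tsum_rpow (by norm_num)]
        simp only [inducedFun_apply, LinearIsometryEquiv.norm_map]
        exact congrArg (· ^ (1 / (2 : ENNReal).toReal))
          ((MulAction.toPerm (β := G ⧸ K) g⁻¹).tsum_eq fun q => ‖f q‖ ^ (2 : ENNReal).toReal) }
  map_one' := by ext1 f; exact inducedFun_one θ f
  map_mul' g h := by ext1 f; exact inducedFun_mul θ g h f

/-- The representation `ρ` is contained in the representation `σ`: it is unitarily equivalent to a
subrepresentation of `σ`. -/
def IsContainedIn (ρ : UnitaryRep G W) (σ : UnitaryRep G V) : Prop :=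
  ∃ U : W →ₗᵢ[ℂ] V, ∀ g w, U (ρ g w) = σ g (U w)

end UnitaryRep

universe w

/-- A unitary representation is Ind-mixing if it contains no representation induced by a non-zero
finite-dimensional unitary representation of a non-trivial subgroup. -/
def UnitaryRep.IsIndMixing {G V : Type*} [Group G] [NormedAddCommGroup V] [InnerProductSpace ℂ V]
    (σ : UnitaryRep G V) : Prop :=
  ∀ (K : Subgroup G), K ≠ ⊥ →
    ∀ (W : Type w) [NormedAddCommGroup W] [InnerProductSpace ℂ W] [FiniteDimensional ℂ W]
      [Nontrivial W] (θ : UnitaryRep K W), ¬ UnitaryRep.IsContainedIn (UnitaryRep.induced θ) σ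

/-- The Pythagorean pair over the one-dimensional Hilbert space `ℂ` given by the scalar
multiplications by `a` and `b`, where `(a, b)` is a point of the unit sphere of `ℂ²`. -/
noncomputable def scalarPair (a b : ℂ) (h : ‖a‖ ^ 2 + ‖b‖ ^ 2 = 1) : PythagoreanPair ℂ where
  A := a • ContinuousLinearMap.id ℂ ℂ
  B := b • ContinuousLinearMap.id ℂ ℂ
  adjoint_mul_add := by
    have h' : (starRingEnd ℂ) a * a + (starRingEnd ℂ) b * b = 1 := by
      rw [← Complex.normSq_eq_conj_mul_self, ← Complex.normSq_eq_conj_mul_self,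
        Complex.normSq_eq_norm_sq, Complex.normSq_eq_norm_sq]
      exact_mod_cast h
    have hid : ContinuousLinearMap.adjoint (ContinuousLinearMap.id ℂ ℂ) =
        ContinuousLinearMap.id ℂ ℂ := by
      rw [← ContinuousLinearMap.star_eq_adjoint]; exact star_one (ℂ →L[ℂ] ℂ)
    rw [map_smulₛₗ, map_smulₛₗ, hid]
    ext
    simpa [mul_comm] using h'

/-!
Let `p` run over the vertices of the infinite binary tree and let `δ_p` be the unit vector at `p` in
the space of the Pythagorean representation `σ`, so that `δ_p = a δ_{p0} + b δ_{p1}`; these vectors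
span a dense subspace, and vectors at incomparable vertices are orthogonal. An element of `F` mapping
the cylinder of `u` onto that of `v` in the standard way maps `δ_u` to `δ_v`
(`PythagoreanPair.rep_vertexVec`). For every `p` there is `g_p ∈ F`, supported in the cylinder of
`p`, which maps the cylinder of `p1` onto that of `p11` (`ThompsonF.exists_supported`).

Suppose that the representation induced from `θ : K → U(W)` is contained in `σ`. The copy of `W` over
the coset `K` is then a finite-dimensional subspace of the space of `σ`, invariant under `K`, and
moved to an orthogonal subspace by the elements outside `K` (`UnitaryRep.exists_fibre`). Let `x ≠ 0`
be a vector of this copy.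

* Since `|a|, |b| < 1`, the mass that a vector has below `p` is small when `p` is deep, whatever the
  direction, so `σ(g_p)` converges strongly to the identity as the length of `p` grows
  (`PythagoreanPair.exists_forall_norm_rep_sub_lt`). Hence `σ(g_p) x` is not orthogonal to `x`, and
  `g_p ∈ K`, for all deep `p`.
* The element `g_p` shifts the orthonormal sequence of the vectors at `p10, p110, p1110, …`. Their
  projections to the finite-dimensional copy of `W` tend to zero, but have constant norm because
  `g_p ∈ K` preserves the copy; so they vanish, and `x` is orthogonal to the vector at `p10`
  (`PythagoreanPair.inner_vertexVec_eq_zero`).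
* A vector orthogonal to the vectors at `p10` for all deep `p` is zero, by the relation
  `δ_p = a δ_{p0} + b δ_{p1}` and `|a|, |b| < 1` (`PythagoreanPair.eq_zero_of_inner_vertexVec`).
-/

open BTree

/-! ### Vertices of the infinite binary tree and trees having them as leaves -/

namespace BTree

/-- The smallest tree having the vertex `w` as a leaf. -/
def spine : List Bool → BTree
  | [] => .leaf
  | false :: w => .caret (spine w) .leaf
  | true :: w => .caret .leaf (spine w)

/-- The vertex `w`, as a leaf of `spine w`. -/
def spineLeaf : (w : List Bool) → (spine w).Leaf
  | [] => .here
  | false :: w => .left (spineLeaf w)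
  | true :: w => .right (spineLeaf w)

theorem word_spineLeaf : (w : List Bool) → (spineLeaf w).word = w
  | [] => rfl
  | false :: w => congrArg (false :: ·) (word_spineLeaf w)
  | true :: w => congrArg (true :: ·) (word_spineLeaf w)

theorem spine_word_le : {t : BTree} → (a : t.Leaf) → (spine a.word).IsSubtree t
  | _, .here => trivial
  | _, .left a => ⟨spine_word_le a, trivial⟩
  | _, .right a => ⟨trivial, spine_word_le a⟩

/-- Two vertices, none of which is a descendant of the other, are leaves of a common tree. -/
theorem exists_leaf_leaf : (u v : List Bool) → ¬ u <+: v → ¬ v <+: u →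
    ∃ (t : BTree) (a b : t.Leaf), a.word = u ∧ b.word = v
  | [], v, h, _ => absurd List.nil_prefix h
  | u, [], _, h => absurd List.nil_prefix h
  | false :: u, false :: v, h, k => by
      obtain ⟨t, a, b, rfl, rfl⟩ := exists_leaf_leaf u v (by simpa using h) (by simpa using k)
      exact ⟨.caret t .leaf, a.left, b.left, rfl, rfl⟩
  | true :: u, true :: v, h, k => by
      obtain ⟨t, a, b, rfl, rfl⟩ := exists_leaf_leaf u v (by simpa using h) (by simpa using k)
      exact ⟨.caret .leaf t, a.right, b.right, rfl, rfl⟩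
  | false :: u, true :: v, _, _ =>
      ⟨.caret (spine u) (spine v), (spineLeaf u).left, (spineLeaf v).right,
        congrArg (false :: ·) (word_spineLeaf u), congrArg (true :: ·) (word_spineLeaf v)⟩
  | true :: u, false :: v, _, _ =>
      ⟨.caret (spine v) (spine u), (spineLeaf u).right, (spineLeaf v).left,
        congrArg (true :: ·) (word_spineLeaf u), congrArg (false :: ·) (word_spineLeaf v)⟩

/-- Every tree `s` can be enlarged to a tree containing the vertex `u`; then `r` is the part of
the enlarged tree below `u`. -/
theorem exists_le_forall_leaf : (u : List Bool) → (s : BTree) →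
    ∃ s', s ≤ s' ∧ ∃ r : BTree, ∀ b : r.Leaf, ∃ a : s'.Leaf, a.word = u ++ b.word
  | [], s => ⟨s, le_refl s, s, fun b => ⟨b, rfl⟩⟩
  | c :: u, s => by
      obtain ⟨l, r, hs⟩ : ∃ l r, s ≤ .caret l r := by
        cases s with
        | leaf => exact ⟨.leaf, .leaf, trivial⟩
        | caret l r => exact ⟨l, r, le_refl _⟩
      cases c with
      | false =>
        obtain ⟨l', hl, q, hq⟩ := exists_le_forall_leaf u l
        refine ⟨.caret l' r, hs.trans ⟨hl, IsSubtree.refl r⟩, q, fun b => ?_⟩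
        obtain ⟨a, ha⟩ := hq b
        exact ⟨a.left, congrArg (false :: ·) ha⟩
      | true =>
        obtain ⟨r', hr, q, hq⟩ := exists_le_forall_leaf u r
        refine ⟨.caret l r', hs.trans ⟨IsSubtree.refl l, hr⟩, q, fun b => ?_⟩
        obtain ⟨a, ha⟩ := hq b
        exact ⟨a.right, congrArg (true :: ·) ha⟩

/-! ### Elements of Thompson's group -/

theorem exists_eq_prepend : (t : BTree) → (x : CantorSeq) →
    ∃ (a : t.Leaf) (y : CantorSeq), x = prepend a.word y
  | .leaf, x => ⟨.here, x, rfl⟩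
  | .caret l r, x => by
      have hx : x = prepend [x 0] fun n => x (n + 1) := by funext n; cases n <;> rfl
      cases h : x 0 with
      | false =>
        obtain ⟨a, y, hy⟩ := exists_eq_prepend l fun n => x (n + 1)
        refine ⟨a.left, y, ?_⟩
        rw [hx, hy, h, ← prepend_append]; rfl
      | true =>
        obtain ⟨a, y, hy⟩ := exists_eq_prepend r fun n => x (n + 1)
        refine ⟨a.right, y, ?_⟩
        rw [hx, hy, h, ← prepend_append]; rfl

end BTree

theorem prepend_cons_inj {b c : Bool} {v w : List Bool} {x y : CantorSeq}
    (h : prepend (b :: v) x = prepend (c :: w) y) : b = c ∧ prepend v x = prepend w y :=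
  ⟨congrFun h 0, funext fun n => congrFun h (n + 1)⟩

namespace BTree

theorem prepend_word_injective : {t : BTree} → {a b : t.Leaf} → {x y : CantorSeq} →
    prepend a.word x = prepend b.word y → a = b ∧ x = y
  | _, .here, .here, _, _, h => ⟨rfl, h⟩
  | _, .left a, .left b, _, _, h => by
      obtain ⟨rfl, rfl⟩ := prepend_word_injective (prepend_cons_inj h).2
      exact ⟨rfl, rfl⟩
  | _, .right a, .right b, _, _, h => by
      obtain ⟨rfl, rfl⟩ := prepend_word_injective (prepend_cons_inj h).2
      exact ⟨rfl, rfl⟩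
  | _, .left a, .right b, _, _, h => by cases (prepend_cons_inj h).1
  | _, .right a, .left b, _, _, h => by cases (prepend_cons_inj h).1

end BTree

theorem continuous_prepend : (w : List Bool) → Continuous (prepend w)
  | [] => continuous_id
  | b :: w => by
      refine continuous_pi fun n => ?_
      cases n with
      | zero => exact continuous_const
      | succ n => exact (continuous_apply n).comp (continuous_prepend w)

/-- The Cantor space is the disjoint union of the cylinders at the leaves of a tree. -/
theorem BTree.exists_homeomorph_leaf (t : BTree) :
    ∃ φ : (Σ _ : t.Leaf, CantorSeq) ≃ₜ CantorSeq, ∀ a x, φ ⟨a, x⟩ = prepend a.word x := by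
  have hb : Function.Bijective fun p : Σ _ : t.Leaf, CantorSeq => prepend p.1.word p.2 := by
    refine ⟨fun p q h => ?_, fun x => ?_⟩
    · obtain ⟨p, x⟩ := p
      obtain ⟨q, y⟩ := q
      obtain ⟨rfl, rfl⟩ := prepend_word_injective h
      rfl
    · obtain ⟨a, y, rfl⟩ := exists_eq_prepend t x
      exact ⟨⟨a, y⟩, rfl⟩
  have hc : Continuous (Equiv.ofBijective _ hb) :=
    continuous_sigma fun a => continuous_prepend a.word
  exact ⟨hc.homeoOfEquivCompactToT2, fun _ _ => rfl⟩

/-- Every pair of trees with the same number of leaves describes an element of `F`. -/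
theorem ThompsonF.exists_isTreeDiagram {t s : BTree} (e : s.Leaf ≃o t.Leaf) :
    ∃ g : ThompsonF, IsTreeDiagram g.1 t s e := by
  obtain ⟨φ, hφ⟩ := s.exists_homeomorph_leaf
  obtain ⟨ψ, hψ⟩ := t.exists_homeomorph_leaf
  let m : (Σ _ : s.Leaf, CantorSeq) ≃ₜ (Σ _ : t.Leaf, CantorSeq) :=
    { toFun := fun p => ⟨e p.1, p.2⟩
      invFun := fun p => ⟨e.symm p.1, p.2⟩
      left_inv := fun p => by simp
      right_inv := fun p => by simp
      continuous_toFun := continuous_sigma fun a =>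
        continuous_sigmaMk (σ := fun _ : t.Leaf => CantorSeq) (i := e a)
      continuous_invFun := continuous_sigma fun a =>
        continuous_sigmaMk (σ := fun _ : s.Leaf => CantorSeq) (i := e.symm a) }
  have h : IsTreeDiagram ((φ.symm.trans m).trans ψ) t s e := fun a x => by
    have : φ.symm (prepend a.word x) = ⟨a, x⟩ := by rw [← hφ, φ.symm_apply_apply]
    rw [Homeomorph.trans_apply, Homeomorph.trans_apply, this, ← hψ]
    rfl
  exact ⟨⟨_, t, s, e, h⟩, h⟩

namespace BTree

theorem Leaf.left_lt_left {l r : BTree} {a b : l.Leaf} :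
    (Leaf.left a : (BTree.caret l r).Leaf) < Leaf.left b ↔ a < b := by
  change false :: a.word < false :: b.word ↔ a.word < b.word
  simp

theorem Leaf.right_lt_right {l r : BTree} {a b : r.Leaf} :
    (Leaf.right a : (BTree.caret l r).Leaf) < Leaf.right b ↔ a < b := by
  change true :: a.word < true :: b.word ↔ a.word < b.word
  simp

theorem Leaf.left_lt_right {l r : BTree} (a : l.Leaf) (b : r.Leaf) :
    Leaf.left a < Leaf.right b := by
  change false :: a.word < true :: b.word
  simp [List.cons_lt_cons_iff]

/-- The order isomorphism on the leaves of a caret with trees attached to its two leaves. -/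
noncomputable def Leaf.caretCongr {l r l' r' : BTree} (e : l.Leaf ≃o l'.Leaf)
    (d : r.Leaf ≃o r'.Leaf) : (BTree.caret l r).Leaf ≃o (BTree.caret l' r').Leaf :=
  StrictMono.orderIsoOfSurjective
    (fun | .left a => .left (e a)
         | .right a => .right (d a))
    (by
      intro a b h
      cases a with
      | left a =>
        cases b with
        | left b => exact Leaf.left_lt_left.2 (e.strictMono (Leaf.left_lt_left.1 h))
        | right b => exact Leaf.left_lt_right _ _
      | right a =>
        cases b with
        | left b => exact absurd h (Leaf.left_lt_right _ _).asymm
        | right b => exact Leaf.right_lt_right.2 (d.strictMono (Leaf.right_lt_right.1 h)))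
    (by
      intro a
      cases a with
      | left a => exact ⟨.left (e.symm a), by simp⟩
      | right a => exact ⟨.right (d.symm a), by simp⟩)

/-- The left-to-right bijection between the leaves of the two trees with three leaves. -/
noncomputable def Leaf.rotate :
    (BTree.caret (.caret .leaf .leaf) .leaf).Leaf ≃o (BTree.caret .leaf (.caret .leaf .leaf)).Leaf :=
  StrictMono.orderIsoOfSurjective
    (fun | .left (.left _) => .left .here
         | .left (.right _) => .right (.left .here)
         | .right _ => .right (.right .here))
    (by
      intro a b h
      casesm* BTree.Leaf _ <;>
        first
        | exact absurd h (lt_irrefl _)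
        | exact absurd h (Leaf.left_lt_right _ _).asymm
        | exact absurd h (Leaf.left_lt_left.2 (Leaf.left_lt_right _ _)).asymm
        | exact Leaf.left_lt_right _ _
        | exact Leaf.right_lt_right.2 (Leaf.left_lt_right _ _))
    (by
      intro a
      casesm* BTree.Leaf _
      exacts [⟨.left (.left .here), rfl⟩, ⟨.left (.right .here), rfl⟩, ⟨.right .here, rfl⟩])

end BTree

/-- Every element of `F` can be made to act below a given child of the root. -/
theorem ThompsonF.exists_cons (g : ThompsonF) (c : Bool) :
    ∃ g' : ThompsonF, (∀ x, g'.1 (prepend [c] x) = prepend [c] (g.1 x)) ∧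
      ∀ x, g'.1 (prepend [!c] x) = prepend [!c] x := by
  obtain ⟨t, s, e, hg⟩ := g.2
  cases c with
  | false =>
    obtain ⟨g', h⟩ := exists_isTreeDiagram
      (Leaf.caretCongr e (OrderIso.refl (BTree.leaf).Leaf))
    refine ⟨g', fun x => ?_, fun x => h (.right .here) x⟩
    obtain ⟨a, y, rfl⟩ := s.exists_eq_prepend x
    rw [hg, ← prepend_append, ← prepend_append]
    exact h (.left a) y
  | true =>
    obtain ⟨g', h⟩ := exists_isTreeDiagram
      (Leaf.caretCongr (OrderIso.refl (BTree.leaf).Leaf) e)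
    refine ⟨g', fun x => ?_, fun x => h (.left .here) x⟩
    obtain ⟨a, y, rfl⟩ := s.exists_eq_prepend x
    rw [hg, ← prepend_append, ← prepend_append]
    exact h (.right a) y

/-- For every vertex `p` there is an element of `F` supported in the cylinder of `p` and
mapping the cylinder of `p1` onto that of `p11`. -/
theorem ThompsonF.exists_supported : (p : List Bool) →
    ∃ g : ThompsonF, (∀ x, g.1 (prepend (p ++ [true]) x) = prepend (p ++ [true, true]) x) ∧
      ∀ u, ¬ u <+: p → ¬ p <+: u → ∀ x, g.1 (prepend u x) = prepend u x
  | [] => by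
      obtain ⟨g, h⟩ := exists_isTreeDiagram Leaf.rotate
      exact ⟨g, fun x => h (.right .here) x, fun u _ h => absurd List.nil_prefix h⟩
  | c :: p => by
      obtain ⟨g, hp, hu⟩ := exists_supported p
      obtain ⟨g', hc, hn⟩ := exists_cons g c
      refine ⟨g', fun x => ?_, fun u h k x => ?_⟩
      · have := hc (prepend (p ++ [true]) x)
        rw [hp, ← prepend_append, ← prepend_append] at this
        exact this
      · cases u with
        | nil => exact absurd List.nil_prefix h
        | cons d u =>
          change g'.1 (prepend ([d] ++ u) x) = prepend ([d] ++ u) x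
          rw [prepend_append]
          by_cases hd : d = c
          · subst hd
            rw [hc, hu u (by simpa using h) (by simpa using k)]
          · obtain rfl : d = !c := by cases d <;> cases c <;> simp_all
            exact hn _

/-! ### The vectors at the vertices of the infinite binary tree -/

theorem BTree.Leaf.single_left {l r : BTree} (a : l.Leaf) :
    (fun b : l.Leaf => (Pi.single a.left 1 : (BTree.caret l r).Leaf → ℂ) b.left) =
      Pi.single a 1 := by
  funext b
  simp [Pi.single_apply]

theorem BTree.Leaf.single_right {l r : BTree} (a : r.Leaf) :
    (fun b : r.Leaf => (Pi.single a.right 1 : (BTree.caret l r).Leaf → ℂ) b.right) =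
      Pi.single a 1 := by
  funext b
  simp [Pi.single_apply]

theorem BTree.Leaf.single_left_right {l r : BTree} (a : l.Leaf) :
    (fun b : r.Leaf => (Pi.single a.left 1 : (BTree.caret l r).Leaf → ℂ) b.right) =
      fun _ => 0 := by
  funext b
  simp

theorem BTree.Leaf.single_right_left {l r : BTree} (a : r.Leaf) :
    (fun b : l.Leaf => (Pi.single a.right 1 : (BTree.caret l r).Leaf → ℂ) b.left) =
      fun _ => 0 := by
  funext b
  simp

namespace PythagoreanPair

variable (P : PythagoreanPair ℂ)

/-- The class of the tree `t` with one leaf decorated by `1` and all others by `0`. -/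
noncomputable def leafVec {t : BTree} (a : t.Leaf) : P.PreLimit :=
  P.cls t (EuclideanSpace.single a 1)

/-- The unit vector at the vertex `w` of the infinite binary tree. -/
noncomputable def vertexVec (w : List Bool) : P.PreLimit :=
  P.leafVec (spineLeaf w)

theorem grow_zero {t s : BTree} (h : t.IsSubtree s) (a : s.Leaf) :
    P.grow h (fun _ => 0) a = 0 := by
  simpa using P.grow_smul 0 h (fun _ => 0) a

/-- Growing `spine a.word` into a tree that also has the leaf `a` attaches nothing below `a`. -/
theorem grow_spineLeaf_word : {t : BTree} → (a b : t.Leaf) →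
    P.grow (spine_word_le a) (Pi.single (spineLeaf a.word) 1) b = (Pi.single a 1 : _ → ℂ) b
  | _, .here, .here => rfl
  | _, .left a, .left b => by
    change P.grow (spine_word_le a) _ b = _
    refine Eq.trans ?_ ((grow_spineLeaf_word a b).trans (by simp [Pi.single_apply]))
    exact congrArg (fun ξ => P.grow (spine_word_le a) ξ b) (Leaf.single_left _)
  | _, .right a, .right b => by
    change P.grow (spine_word_le a) _ b = _
    refine Eq.trans ?_ ((grow_spineLeaf_word a b).trans (by simp [Pi.single_apply]))
    exact congrArg (fun ξ => P.grow (spine_word_le a) ξ b) (Leaf.single_right _)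
  | .caret l r, .left a, .right b => by
    rw [Pi.single_eq_of_ne (by simp)]
    refine Eq.trans ?_ (P.grow_zero (t := .leaf) (s := r) trivial b)
    exact congrArg (fun ξ => P.grow (t := .leaf) (s := r) trivial ξ b)
      (Leaf.single_left_right _)
  | .caret l r, .right a, .left b => by
    rw [Pi.single_eq_of_ne (by simp)]
    refine Eq.trans ?_ (P.grow_zero (t := .leaf) (s := l) trivial b)
    exact congrArg (fun ξ => P.grow (t := .leaf) (s := l) trivial ξ b)
      (Leaf.single_right_left _)

/-- The vector at a leaf of a tree depends only on the position of the leaf. -/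
theorem leafVec_eq {t : BTree} (a : t.Leaf) : P.leafVec a = P.vertexVec a.word := by
  rw [vertexVec, leafVec, leafVec, ← P.cls_connect (spine_word_le a)]
  congr 1
  ext b
  rw [connect_apply]
  exact (P.grow_spineLeaf_word a b).symm

theorem norm_cls {t : BTree} (ξ : Decoration ℂ t) : ‖P.cls t ξ‖ = ‖ξ‖ := by
  rw [@norm_eq_sqrt_re_inner ℂ, @norm_eq_sqrt_re_inner ℂ, inner_cls]

theorem norm_vertexVec (w : List Bool) : ‖P.vertexVec w‖ = 1 := by
  rw [vertexVec, leafVec, norm_cls]; simp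

theorem inner_vertexVec {u v : List Bool} (h : ¬ u <+: v) (k : ¬ v <+: u) :
    inner ℂ (P.vertexVec u) (P.vertexVec v) = 0 := by
  obtain ⟨t, a, b, rfl, rfl⟩ := exists_leaf_leaf u v h k
  rw [← leafVec_eq, ← leafVec_eq, leafVec, leafVec, inner_cls]
  have : a ≠ b := by rintro rfl; exact h (List.prefix_refl _)
  exact (EuclideanSpace.inner_single_left a 1 _).trans (by simp [this])

/-- The decomposition of the vector at a vertex into vectors at the two children. -/
theorem vertexVec_eq (w : List Bool) : P.vertexVec w =
    P.A 1 • P.vertexVec (w ++ [false]) + P.B 1 • P.vertexVec (w ++ [true]) := by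
  -- the tree obtained from `spine w` by attaching a caret at `w`
  have key : ∀ w : List Bool, ∃ (t : BTree) (h : (spine w).IsSubtree t) (a b : t.Leaf),
      a.word = w ++ [false] ∧ b.word = w ++ [true] ∧ ∀ c, P.grow h (Pi.single (spineLeaf w) 1) c =
        P.A 1 * (Pi.single a 1 : _ → ℂ) c + P.B 1 * (Pi.single b 1 : _ → ℂ) c := by
    intro w
    induction w with
    | nil =>
      refine ⟨.caret .leaf .leaf, trivial, .left .here, .right .here, rfl, rfl, ?_⟩
      intro c
      casesm* BTree.Leaf _
      · change P.A ((Pi.single Leaf.here 1 : BTree.leaf.Leaf → ℂ) Leaf.here) = _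
        rw [Pi.single_eq_same]
        simp
      · change P.B ((Pi.single Leaf.here 1 : BTree.leaf.Leaf → ℂ) Leaf.here) = _
        rw [Pi.single_eq_same]
        simp
    | cons d w ih =>
      obtain ⟨t, h, a, b, ha, hb, hc⟩ := ih
      cases d with
      | false =>
        refine ⟨.caret t .leaf, ⟨h, trivial⟩, .left a, .left b, congrArg (false :: ·) ha,
          congrArg (false :: ·) hb, fun c => ?_⟩
        cases c with
        | left c =>
          refine Eq.trans ?_ ((hc c).trans (by simp [Pi.single_apply]))
          exact congrArg (fun ξ => P.grow h ξ c) (Leaf.single_left _)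
        | right c =>
          rw [Pi.single_eq_of_ne (by simp), Pi.single_eq_of_ne (by simp)]
          refine Eq.trans ?_ ((P.grow_zero (t := .leaf) (s := .leaf) trivial c).trans (by simp))
          exact congrArg (fun ξ => P.grow (t := .leaf) (s := .leaf) trivial ξ c)
            (Leaf.single_left_right _)
      | true =>
        refine ⟨.caret .leaf t, ⟨trivial, h⟩, .right a, .right b, congrArg (true :: ·) ha,
          congrArg (true :: ·) hb, fun c => ?_⟩
        cases c with
        | right c =>
          refine Eq.trans ?_ ((hc c).trans (by simp [Pi.single_apply]))
          exact congrArg (fun ξ => P.grow h ξ c) (Leaf.single_right _)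
        | left c =>
          rw [Pi.single_eq_of_ne (by simp), Pi.single_eq_of_ne (by simp)]
          refine Eq.trans ?_ ((P.grow_zero (t := .leaf) (s := .leaf) trivial c).trans (by simp))
          exact congrArg (fun ξ => P.grow (t := .leaf) (s := .leaf) trivial ξ c)
            (Leaf.single_right_left _)
  obtain ⟨t, h, a, b, ha, hb, hc⟩ := key w
  rw [← ha, ← hb, ← leafVec_eq, ← leafVec_eq, vertexVec, leafVec, leafVec, leafVec,
    ← cls_smul, ← cls_smul, ← cls_add, ← P.cls_connect (show spine w ≤ t from h)]
  congr 1
  ext c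
  rw [connect_apply]
  exact (hc c).trans (by simp [Pi.single_apply])

theorem span_vertexVec : Submodule.span ℂ (Set.range P.vertexVec) = ⊤ := by
  refine Submodule.eq_top_iff'.2 fun x => P.induction₁ (fun t ξ => ?_) x
  let f : Decoration ℂ t →ₗ[ℂ] P.PreLimit :=
    { toFun := P.cls t, map_add' := P.cls_add, map_smul' := P.cls_smul }
  have hξ : ξ = ∑ a, ξ a • EuclideanSpace.single a (1 : ℂ) := by
    ext b
    simp [Finset.sum_apply, Pi.single_apply]
  change f ξ ∈ _
  rw [hξ, map_sum]
  refine Submodule.sum_mem _ fun a _ => ?_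
  rw [map_smul]
  refine Submodule.smul_mem _ _ (Submodule.subset_span ⟨a.word, ?_⟩)
  rw [← leafVec_eq]; rfl

/-! ### The action on these vectors -/

theorem rep_leafVec {g : ThompsonF} {t s : BTree} {e : s.Leaf ≃o t.Leaf}
    (hg : IsTreeDiagram g.1 t s e) (a : s.Leaf) :
    P.rep g (P.leafVec a : P.Limit) = (P.leafVec (e a) : P.PreLimit) := by
  rw [leafVec, P.rep_cls hg, leafVec]
  congr 2
  ext b
  rw [Decoration.relabel_apply]
  simp [OrderIso.symm_apply_eq]

/-- By the relation between a vertex and its children, an equation between the vectors at `u` and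
`v` follows from those between the vectors at the leaves of a tree `r` attached at `u` and `v`. -/
theorem rep_vertexVec_of_forall_leaf {g : ThompsonF} : (r : BTree) → (u v : List Bool) →
    (∀ b : r.Leaf, P.rep g (P.vertexVec (u ++ b.word) : P.Limit) =
      (P.vertexVec (v ++ b.word) : P.PreLimit)) →
    P.rep g (P.vertexVec u : P.Limit) = (P.vertexVec v : P.PreLimit)
  | .leaf, u, v, h => by simpa [Leaf.word] using h .here
  | .caret l r, u, v, h => by
      have hl := rep_vertexVec_of_forall_leaf l (u ++ [false]) (v ++ [false]) fun b => by
        simpa [Leaf.word] using h b.left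
      have hr := rep_vertexVec_of_forall_leaf r (u ++ [true]) (v ++ [true]) fun b => by
        simpa [Leaf.word] using h b.right
      rw [P.vertexVec_eq u, P.vertexVec_eq v]
      push_cast
      rw [map_add, map_smul, map_smul, hl, hr]

/-- An element of `F` that maps the cylinder of `u` to that of `v` in the standard way maps the
vector at `u` to the vector at `v`. -/
theorem rep_vertexVec {g : ThompsonF} {u v : List Bool}
    (h : ∀ x, g.1 (prepend u x) = prepend v x) :
    P.rep g (P.vertexVec u : P.Limit) = (P.vertexVec v : P.PreLimit) := by
  obtain ⟨t, s, e, hg⟩ := g.2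
  obtain ⟨s', hs, r, hr⟩ := exists_le_forall_leaf u s
  obtain ⟨t', -, e', hg'⟩ := hg.exists_source hs
  refine P.rep_vertexVec_of_forall_leaf r u v fun b => ?_
  obtain ⟨a, ha⟩ := hr b
  have : (e' a).word = v ++ b.word := prepend_injective fun x => by
    rw [← hg', ha, prepend_append, prepend_append, h]
  rw [← ha, ← this, ← leafVec_eq, ← leafVec_eq, P.rep_leafVec hg']

end PythagoreanPair

/-! ### Small supports act almost trivially -/

namespace PythagoreanPair

variable (P : PythagoreanPair ℂ)

theorem norm_coe_vertexVec (w : List Bool) : ‖(P.vertexVec w : P.Limit)‖ = 1 := by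
  rw [UniformSpace.Completion.norm_coe, norm_vertexVec]

theorem coe_vertexVec_eq (w : List Bool) : (P.vertexVec w : P.Limit) =
    P.A 1 • (P.vertexVec (w ++ [false]) : P.Limit) + P.B 1 • (P.vertexVec (w ++ [true]) : P.Limit) := by
  conv_lhs => rw [P.vertexVec_eq w]
  push_cast
  rfl

/-- An element supported in the cylinder of a vertex `p` moves the vector of an ancestor `u` of
`p` little if `p` is far below `u`: only the component at `p` is moved. -/
theorem norm_rep_vertexVec_sub_le {c : ℝ} (hA : ‖P.A 1‖ ≤ c) (hB : ‖P.B 1‖ ≤ c) {g : ThompsonF}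
    {p : List Bool} (hg : ∀ u, ¬ u <+: p → ¬ p <+: u → ∀ x, g.1 (prepend u x) = prepend u x)
    (q u : List Bool) (hq : p = u ++ q) :
    ‖P.rep g (P.vertexVec u : P.Limit) - (P.vertexVec u : P.Limit)‖ ≤ 2 * c ^ q.length := by
  have hc : 0 ≤ c := (norm_nonneg _).trans hA
  induction q generalizing u with
  | nil =>
    refine (norm_sub_le _ _).trans ?_
    rw [LinearIsometryEquiv.norm_map, norm_coe_vertexVec]
    norm_num
  | cons d q ih =>
    have h1 := ih (u ++ [d]) (by simp [hq])
    have h2 : P.rep g (P.vertexVec (u ++ [!d]) : P.Limit) = (P.vertexVec (u ++ [!d]) : P.Limit) :=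
      P.rep_vertexVec <| by
        refine hg _ ?_ ?_ <;> rw [hq, List.prefix_append_right_inj] <;> cases d <;> simp
    rw [coe_vertexVec_eq, map_add, map_smul, map_smul, List.length_cons, pow_succ]
    cases d with
    | false =>
      rw [Bool.not_false] at h2
      rw [h2, add_sub_add_right_eq_sub, ← smul_sub, norm_smul]
      calc _ ≤ c * (2 * c ^ q.length) := by gcongr
        _ = _ := by ring
    | true =>
      rw [Bool.not_true] at h2
      rw [h2, add_sub_add_left_eq_sub, ← smul_sub, norm_smul]
      calc _ ≤ c * (2 * c ^ q.length) := by gcongr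
        _ = _ := by ring

/-- Elements of `F` supported in cylinders of deep vertices converge strongly to the identity. -/
theorem exists_forall_norm_rep_sub_lt (hA : ‖P.A 1‖ < 1) (hB : ‖P.B 1‖ < 1) (x : P.Limit) {ε : ℝ}
    (hε : 0 < ε) : ∃ m : ℕ, ∀ (p : List Bool) (g : ThompsonF), m ≤ p.length →
      (∀ u, ¬ u <+: p → ¬ p <+: u → ∀ y, g.1 (prepend u y) = prepend u y) →
      ‖P.rep g x - x‖ < ε := by
  have h0 : ∀ y : P.PreLimit, ∀ ε > 0, ∃ m : ℕ, ∀ (p : List Bool) (g : ThompsonF), m ≤ p.length →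
      (∀ u, ¬ u <+: p → ¬ p <+: u → ∀ y, g.1 (prepend u y) = prepend u y) →
      ‖P.rep g (y : P.Limit) - y‖ < ε := by
    intro y
    have hy : y ∈ Submodule.span ℂ (Set.range P.vertexVec) := by
      rw [span_vertexVec]; trivial
    induction hy using Submodule.span_induction with
    | mem y hy =>
      obtain ⟨u, rfl⟩ := hy
      intro ε hε
      obtain ⟨n, hn⟩ := exists_pow_lt_of_lt_one (half_pos hε) (max_lt hA hB)
      refine ⟨n + (u.length + 1), fun p g hp hg => ?_⟩
      by_cases hu : u <+: p
      · obtain ⟨q, rfl⟩ := hu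
        rw [List.length_append] at hp
        have h := P.norm_rep_vertexVec_sub_le (le_max_left _ _) (le_max_right _ _) hg q u rfl
        have h' := pow_le_pow_of_le_one ((norm_nonneg _).trans (le_max_left ‖P.A 1‖ ‖P.B 1‖))
          (max_lt hA hB).le (show n ≤ q.length by omega)
        linarith
      · rw [P.rep_vertexVec (hg u hu fun h => by have := h.length_le; omega), sub_self, norm_zero]
        exact hε
    | zero =>
      intro ε hε
      exact ⟨0, fun p g _ _ => by simpa [UniformSpace.Completion.coe_zero] using hε⟩
    | add y z _ _ hy hz =>
      intro ε hε
      obtain ⟨m, hm⟩ := hy (ε / 2) (half_pos hε)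
      obtain ⟨n, hn⟩ := hz (ε / 2) (half_pos hε)
      refine ⟨max m n, fun p g hp hg => ?_⟩
      have h1 := hm p g ((le_max_left _ _).trans hp) hg
      have h2 := hn p g ((le_max_right _ _).trans hp) hg
      push_cast
      rw [map_add, add_sub_add_comm]
      linarith [norm_add_le (P.rep g (y : P.Limit) - y) (P.rep g (z : P.Limit) - z)]
    | smul c y _ hy =>
      intro ε hε
      have hc : 0 < ‖c‖ + 1 := by positivity
      obtain ⟨m, hm⟩ := hy (ε / (‖c‖ + 1)) (by positivity)
      refine ⟨m, fun p g hp hg => ?_⟩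
      have h1 := hm p g hp hg
      push_cast
      rw [map_smul, ← smul_sub, norm_smul]
      rw [lt_div_iff₀ hc] at h1
      nlinarith [norm_nonneg (P.rep g (y : P.Limit) - y)]
  obtain ⟨y, hy⟩ := (UniformSpace.Completion.denseRange_coe (α := P.PreLimit)).exists_dist_lt x
    (show 0 < ε / 4 by positivity)
  obtain ⟨m, hm⟩ := h0 y (ε / 2) (half_pos hε)
  refine ⟨m, fun p g hp hg => ?_⟩
  have h1 := hm p g hp hg
  rw [dist_eq_norm] at hy
  have h2 : P.rep g x - x = P.rep g (x - y) + (P.rep g (y : P.Limit) - y) - (x - y) := by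
    rw [map_sub]; abel
  rw [h2]
  refine (norm_sub_le _ _).trans_lt ?_
  have h3 := norm_add_le (P.rep g (x - y)) (P.rep g (y : P.Limit) - y)
  rw [LinearIsometryEquiv.norm_map] at h3
  linarith

/-! ### Vectors orthogonal to finite-dimensional invariant subspaces -/

/-- If `g` shifts the vectors at the vertices `p 1 … 1 0`, these vectors are
orthogonal to the range of any isometric embedding of a finite-dimensional space which commutes
with the action of `g⁻¹` up to a unitary operator. -/
theorem inner_vertexVec_eq_zero {W : Type*} [NormedAddCommGroup W] [InnerProductSpace ℂ W]
    [FiniteDimensional ℂ W] (ι : W →ₗᵢ[ℂ] P.Limit) {g : ThompsonF} {p : List Bool}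
    (hg : ∀ x, g.1 (prepend (p ++ [true]) x) = prepend (p ++ [true, true]) x)
    {u : W ≃ₗᵢ[ℂ] W} (hu : ∀ w, P.rep g⁻¹ (ι w) = ι (u w)) (w : W) :
    inner ℂ (P.vertexVec (p ++ [true, false]) : P.Limit) (ι w) = 0 := by
  let v : ℕ → P.Limit := fun n =>
    (P.vertexVec (p ++ true :: (List.replicate n true ++ [false])) : P.PreLimit)
  have hv : ∀ n, P.rep g (v n) = v (n + 1) := fun n => P.rep_vertexVec fun x => by
    have h := hg (prepend (List.replicate n true ++ [false]) x)
    rw [← prepend_append, ← prepend_append] at h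
    simpa [List.replicate_succ] using h
  have key : ∀ i j d : ℕ, j = i + (d + 1) →
      ¬ (p ++ true :: (List.replicate i true ++ [false])) <+:
        (p ++ true :: (List.replicate j true ++ [false])) ∧
      ¬ (p ++ true :: (List.replicate j true ++ [false])) <+:
        (p ++ true :: (List.replicate i true ++ [false])) := by
    rintro i j d rfl
    simp [List.prefix_append_right_inj, List.replicate_add, List.replicate_succ]
  -- the vertices `p 1 … 1 0` are pairwise incomparable
  have hort : Orthonormal ℂ v := by
    refine ⟨fun n => P.norm_coe_vertexVec _, fun i j hij => ?_⟩
    change inner ℂ (v i) (v j) = 0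
    rw [UniformSpace.Completion.inner_coe]
    rcases Nat.lt_or_gt_of_ne hij with h | h
    · obtain ⟨d, rfl⟩ := Nat.exists_eq_add_of_lt h
      exact P.inner_vertexVec (key i _ d rfl).1 (key i _ d rfl).2
    · obtain ⟨d, rfl⟩ := Nat.exists_eq_add_of_lt h
      exact P.inner_vertexVec (key j _ d rfl).2 (key j _ d rfl).1
  have : CompleteSpace W := FiniteDimensional.complete ℂ W
  -- the adjoint `T` of `ι` stands for the projection onto the range of `ι`
  let T := ContinuousLinearMap.adjoint ι.toContinuousLinearMap
  have hT : ∀ y, ‖T (P.rep g y)‖ = ‖T y‖ := by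
    intro y
    have : T (P.rep g y) = u.symm (T y) := by
      refine ext_inner_left ℂ fun w => ?_
      rw [ContinuousLinearMap.adjoint_inner_right, ← LinearIsometryEquiv.inner_map_map u,
        u.apply_symm_apply, ContinuousLinearMap.adjoint_inner_right]
      change inner ℂ (ι w) (P.rep g y) = inner ℂ (ι (u w)) y
      rw [← hu, map_inv, ← LinearIsometryEquiv.inner_map_map (P.rep g) ((P.rep g)⁻¹ (ι w)) y]
      congr 1
      exact ((P.rep g).apply_symm_apply _).symm
    rw [this, LinearIsometryEquiv.norm_map]
  have hconst : ∀ n, ‖T (v n)‖ = ‖T (v 0)‖ := by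
    intro n
    induction n with
    | zero => rfl
    | succ n ih => rw [← hv, hT, ih]
  -- weak convergence to zero, tested on an orthonormal basis of `W`
  have hlim : Filter.Tendsto (fun n => ‖T (v n)‖ ^ 2) Filter.atTop (nhds 0) := by
    let b := stdOrthonormalBasis ℂ W
    have : ∀ n, ‖T (v n)‖ ^ 2 = ∑ i, ‖inner ℂ (v n) (ι (b i))‖ ^ 2 := by
      intro n
      rw [← b.sum_sq_norm_inner_right]
      refine Finset.sum_congr rfl fun i _ => ?_
      rw [ContinuousLinearMap.adjoint_inner_right, norm_inner_symm]
      rfl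
    simp only [this]
    refine (tendsto_finsetSum Finset.univ fun i _ => ?_).trans_eq
      (congrArg nhds Finset.sum_const_zero)
    exact (hort.inner_products_summable (ι (b i))).tendsto_atTop_zero
  simp only [hconst] at hlim
  have hzero : T (v 0) = 0 := by
    simpa using tendsto_nhds_unique tendsto_const_nhds hlim
  have : inner ℂ (T (v 0)) w = inner ℂ (v 0) (ι w) :=
    ContinuousLinearMap.adjoint_inner_left _ _ _
  rw [hzero, inner_zero_left] at this
  exact this.symm

/-- A vector orthogonal to the vectors at all deep vertices of the form `p10` is zero. -/
theorem eq_zero_of_inner_vertexVec (hA : ‖P.A 1‖ < 1) (hB : ‖P.B 1‖ < 1) {x : P.Limit} {m : ℕ}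
    (h : ∀ p : List Bool, m ≤ p.length →
      inner ℂ (P.vertexVec (p ++ [true, false]) : P.Limit) x = 0) : x = 0 := by
  have hle : ∀ w : List Bool, ‖inner ℂ (P.vertexVec w : P.Limit) x‖ ≤
      ‖P.A 1‖ * ‖inner ℂ (P.vertexVec (w ++ [false]) : P.Limit) x‖ +
        ‖P.B 1‖ * ‖inner ℂ (P.vertexVec (w ++ [true]) : P.Limit) x‖ := by
    intro w
    rw [coe_vertexVec_eq, inner_add_left, inner_smul_left, inner_smul_left]
    refine (norm_add_le _ _).trans_eq ?_
    rw [norm_mul, norm_mul, RCLike.norm_conj, RCLike.norm_conj]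
  have hx : ∀ w : List Bool, ‖inner ℂ (P.vertexVec w : P.Limit) x‖ ≤ ‖x‖ := by
    intro w
    simpa [norm_vertexVec] using norm_inner_le_norm (𝕜 := ℂ) (P.vertexVec w : P.Limit) x
  have hzero : ∀ {c r : ℝ}, 0 ≤ c → c < 1 → 0 ≤ r → (∀ n : ℕ, r ≤ c ^ n * ‖x‖) → r = 0 := by
    intro c r h0 h1 hr hn
    have := (tendsto_pow_atTop_nhds_zero_of_lt_one h0 h1).mul_const ‖x‖
    rw [zero_mul] at this
    exact le_antisymm (ge_of_tendsto' this hn) hr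
  -- vertices ending in `1`: the component at the left child vanishes
  have h1 : ∀ p : List Bool, m ≤ p.length →
      inner ℂ (P.vertexVec (p ++ [true]) : P.Limit) x = 0 := by
    have : ∀ (n : ℕ) (p : List Bool), m ≤ p.length →
        ‖inner ℂ (P.vertexVec (p ++ [true]) : P.Limit) x‖ ≤ ‖P.B 1‖ ^ n * ‖x‖ := by
      intro n
      induction n with
      | zero => intro p _; simpa using hx _
      | succ n ih =>
        intro p hp
        have h2 := hle (p ++ [true])
        rw [show p ++ [true] ++ [false] = p ++ [true, false] by simp, h p hp, norm_zero, mul_zero,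
          zero_add] at h2
        refine h2.trans ?_
        have h3 := ih (p ++ [true]) (by rw [List.length_append]; omega)
        rw [pow_succ', mul_assoc]
        exact mul_le_mul_of_nonneg_left h3 (norm_nonneg _)
    exact fun p hp => norm_eq_zero.1
      (hzero (norm_nonneg _) hB (norm_nonneg _) fun n => this n p hp)
  -- all deep vertices: the component at the right child vanishes
  have h2 : ∀ p : List Bool, m ≤ p.length → inner ℂ (P.vertexVec p : P.Limit) x = 0 := by
    have : ∀ (n : ℕ) (p : List Bool), m ≤ p.length →
        ‖inner ℂ (P.vertexVec p : P.Limit) x‖ ≤ ‖P.A 1‖ ^ n * ‖x‖ := by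
      intro n
      induction n with
      | zero => intro p _; simpa using hx _
      | succ n ih =>
        intro p hp
        have h3 := hle p
        rw [h1 p hp, norm_zero, mul_zero, add_zero] at h3
        refine h3.trans ?_
        rw [pow_succ', mul_assoc]
        exact mul_le_mul_of_nonneg_left (ih _ (by rw [List.length_append]; omega)) (norm_nonneg _)
    exact fun p hp => norm_eq_zero.1
      (hzero (norm_nonneg _) hA (norm_nonneg _) fun n => this n p hp)
  -- vertices less deep than `m` are reached from their descendants
  have h3 : ∀ (k : ℕ) (p : List Bool), m ≤ p.length + k →
      inner ℂ (P.vertexVec p : P.Limit) x = 0 := by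
    intro k
    induction k with
    | zero => exact h2
    | succ k ih =>
      intro p hp
      rw [coe_vertexVec_eq, inner_add_left, inner_smul_left, inner_smul_left,
        ih _ (by rw [List.length_append]; simp; omega), ih _ (by rw [List.length_append]; simp; omega)]
      simp
  have h4 : ∀ y : P.Limit, inner ℂ y x = 0 := by
    intro y
    induction y using UniformSpace.Completion.induction_on with
    | hp => exact isClosed_eq (by fun_prop) continuous_const
    | ih y =>
      have hy : y ∈ Submodule.span ℂ (Set.range P.vertexVec) := by
        rw [span_vertexVec]; trivial
      induction hy using Submodule.span_induction with
      | mem y hy =>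
        obtain ⟨u, rfl⟩ := hy
        exact h3 m u (Nat.le_add_left _ _)
      | zero => simp [UniformSpace.Completion.coe_zero]
      | add y z _ _ hy hz => push_cast; rw [inner_add_left, hy, hz, add_zero]
      | smul c y _ hy => push_cast; rw [inner_smul_left, hy, mul_zero]
  exact inner_self_eq_zero.1 (h4 x)

end PythagoreanPair

/-! ### The fibre of an induced representation over the base coset -/

/-- If an induced representation is contained in `σ`, then the copy of `W` over the coset of the
identity is moved into itself by `K`, and to an orthogonal subspace by the elements outside `K`. -/
theorem UnitaryRep.exists_fibre {G V W : Type*} [Group G] [NormedAddCommGroup V]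
    [InnerProductSpace ℂ V] [NormedAddCommGroup W] [InnerProductSpace ℂ W] {K : Subgroup G}
    {θ : UnitaryRep K W} {σ : UnitaryRep G V} (h : IsContainedIn (induced θ) σ) :
    ∃ ι : W →ₗᵢ[ℂ] V, (∀ k ∈ K, ∃ u : W ≃ₗᵢ[ℂ] W, ∀ w, σ k (ι w) = ι (u w)) ∧
      ∀ g ∉ K, ∀ w w', inner ℂ (ι w) (σ g (ι w')) = 0 := by
  classical
  obtain ⟨U, hU⟩ := h
  let q : G ⧸ K := ((1 : G) : G ⧸ K)
  have hq : ∀ k : G, k • q = q ↔ k ∈ K := fun k => by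
    change ((k * 1 : G) : G ⧸ K) = ((1 : G) : G ⧸ K) ↔ _
    rw [eq_comm, QuotientGroup.eq]
    simp
  let S : W →ₗᵢ[ℂ] lp (fun _ : G ⧸ K => W) 2 :=
    { lp.lsingle (E := fun _ : G ⧸ K => W) (𝕜 := ℂ) 2 q with
      norm_map' := fun w => lp.norm_single (E := fun _ : G ⧸ K => W) (p := 2) (by norm_num) q w }
  have hS : ∀ w, S w = lp.single 2 q w := fun _ => rfl
  refine ⟨U.comp S, fun k hk => ⟨θ (cocycle K k⁻¹ q)⁻¹, fun w => ?_⟩, fun g hg w w' => ?_⟩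
  · change σ k (U (S w)) = U (S _)
    rw [← hU]
    congr 1
    ext r
    change θ (cocycle K k⁻¹ r)⁻¹ (S w (k⁻¹ • r)) = _
    by_cases hr : r = q
    · subst hr
      rw [(hq _).2 (K.inv_mem hk), hS, hS, lp.single_apply_self, lp.single_apply_self]
    · have hr' : k⁻¹ • r ≠ q := fun h => hr (by rw [← (hq k).2 hk, ← h, smul_inv_smul])
      rw [hS, hS, lp.single_apply_ne _ _ _ hr', lp.single_apply_ne _ _ _ hr, map_zero]
  · change inner ℂ (U (S w)) (σ g (U (S w'))) = 0
    rw [← hU, U.inner_map_map, hS w, lp.inner_single_left]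
    have hr : g⁻¹ • q ≠ q := fun h => hg (by simpa using (hq _).1 h)
    change inner ℂ w (θ (cocycle K g⁻¹ q)⁻¹ (S w' (g⁻¹ • q))) = 0
    rw [hS, lp.single_apply_ne _ _ _ hr, map_zero, inner_zero_right]

/-! ### The contradiction -/

theorem corollaryB (a b : ℂ) (hab : ‖a‖ ^ 2 + ‖b‖ ^ 2 = 1) (ha : a ≠ 0) (hb : b ≠ 0) :
    UnitaryRep.IsIndMixing.{w} (scalarPair a b hab).rep := by
  intro K _ W _ _ _ _ θ h
  -- `‖a‖ < 1` because `b ≠ 0`, and `‖b‖ < 1` because `a ≠ 0`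
  have ha' : 0 < ‖a‖ := norm_pos_iff.2 ha
  have hb' : 0 < ‖b‖ := norm_pos_iff.2 hb
  have hA : ‖(scalarPair a b hab).A 1‖ < 1 := by
    simp only [scalarPair, smul_apply, ContinuousLinearMap.id_apply, smul_eq_mul, mul_one]
    nlinarith
  have hB : ‖(scalarPair a b hab).B 1‖ < 1 := by
    simp only [scalarPair, smul_apply, ContinuousLinearMap.id_apply, smul_eq_mul, mul_one]
    nlinarith
  obtain ⟨ι, hK, hort⟩ := UnitaryRep.exists_fibre h
  obtain ⟨w, hw⟩ := exists_ne (0 : W)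
  have hw' : 0 < ‖ι w‖ := by rwa [ι.norm_map, norm_pos_iff]
  obtain ⟨m, hm⟩ := (scalarPair a b hab).exists_forall_norm_rep_sub_lt hA hB (ι w) hw'
  refine hw'.ne' (norm_eq_zero.2
    ((scalarPair a b hab).eq_zero_of_inner_vertexVec hA hB (m := m) fun p hp => ?_))
  obtain ⟨g, hg, hsupp⟩ := ThompsonF.exists_supported p
  -- `g` moves `ι w` by less than its norm, hence not to an orthogonal vector
  have hgK : g ∈ K := by
    by_contra hgK
    have h1 := hm p g hp hsupp
    have h2 := norm_sub_sq (𝕜 := ℂ) (ι w) ((scalarPair a b hab).rep g (ι w))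
    rw [hort g hgK, map_zero, mul_zero, sub_zero, LinearIsometryEquiv.norm_map, norm_sub_rev] at h2
    nlinarith [norm_nonneg ((scalarPair a b hab).rep g (ι w) - ι w)]
  obtain ⟨u, hu⟩ := hK g⁻¹ (K.inv_mem hgK)
  exact (scalarPair a b hab).inner_vertexVec_eq_zero ι hg hu w
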